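/- Let $R$ be a local domain whose residue field has characteristic $0$. Let $S/R$ be a simple extension of degree $n$: $S$ is a commutative ring containing $R$ (via an injective ring homomorphism $R\to S$), and there is a unit $c\in S^*$ such that $1,c,\dots,c^{n-1}$ is a basis of $S$ as an $R$-module (equivalently, $n\ge 1$ and $S\cong R[t]/(p)$ with $p$ monic of degree $n$ and $p(0)\in R^*$). Let $N^S_R:S\to R$ be the norm map, where $N^S_R(s)$ is the determinant of multiplication by $s$ on the free $R$-module $S$. Let $q$ be a regular quadratic form over $R$ on a free module of finite rank $m$, i.e. the bilinear form $q(x+y)-q(x)-q(y)$ induces an isomorphism of the module with its dual. Let $q_S=q\otimes_R S$ be the base change of $q$ to $S$, let $D(q_S)\subset S^*$ be the subgroup generated by all units of $S$ of the form $q_S(x)$, and let $D(q)\subset R^*$ be the subgroup generated by all units of $R$ of the form $q(x)$. Then $$N^S_R(D(q_S))\subset D(q).$$ -/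

import Mathlib

open scoped TensorProduct

/-- In a local ring whose residue field has characteristic zero, `2` is invertible.
(`Invertible (2 : R)` is a subsingleton; this instance is what the base change of
quadratic forms requires.) -/
noncomputable instance invertibleTwoOfCharZeroResidueField (R : Type*) [CommRing R] [IsLocalRing R]
    [CharZero (IsLocalRing.ResidueField R)] : Invertible (2 : R) :=
  IsUnit.invertible <| by
    by_contra h
    have h1 : IsLocalRing.residue R 2 = 0 := by
      rw [IsLocalRing.residue_eq_zero_iff]
      exact h
    rw [map_ofNat] at h1
    exact two_ne_zero h1

/-- `S` is a simple extension of `R` of degree `n`: `R → S` is injective, and there is a unit `c`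
of `S` (a primitive element) such that `1, c, …, c ^ (n - 1)` is a basis of the `R`-module `S`. -/
def IsSimpleExtension (R S : Type*) [CommRing R] [CommRing S] [Algebra R S] (n : ℕ) : Prop :=
  Function.Injective (algebraMap R S) ∧
    ∃ c : Sˣ, ∃ b : Module.Basis (Fin n) R S, ∀ i : Fin n, b i = (c : S) ^ (i : ℕ)

/-- A quadratic form on `M` is regular if its polar bilinear form `q (x + y) - q x - q y` induces
an isomorphism from `M` to its dual. -/
def QuadraticForm.IsRegular {R M : Type*} [CommRing R] [AddCommGroup M] [Module R M]
    (q : QuadraticForm R M) : Prop :=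
  Function.Bijective (QuadraticMap.polarBilin q : M →ₗ[R] Module.Dual R M)

/-- `D(q)`: the subgroup of the unit group generated by the units represented by `q`. -/
def QuadraticForm.valueGroup {A M : Type*} [CommRing A] [AddCommGroup M] [Module A M]
    (q : QuadraticForm A M) : Subgroup Aˣ :=
  Subgroup.closure {u : Aˣ | ∃ x : M, q x = (u : A)}

open Polynomial Matrix

/-! Write `S = R[X]/(p)`. A unit value `x` of `q_S` is a congruence `q(v) ≡ x mod p` for a vector
`v` of polynomials. Squares of units lie in `D(q)`, so `x` may be replaced by `T = x Y²`. If `T` is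
a unit generating `S`, with characteristic polynomial `P`, then rewriting `Y v` in powers of `T`
gives `q(u) ≡ X mod P`, and `T` has norm `(-1)^n P(0)`. So everything reduces to
`eval_zero_mem_values`: if `p` divides `q(v) - X` and `p(0)` is a unit, then `(-1)^n p(0)` lies in
`D(q)`.

This is a descent on the degree. If `v` has degree less than `n = deg p`, then `q(v) - X = p h` with
`deg h ≤ n - 2`. Suppose that `q` takes unit values at `v(0)` and at the vector of coefficients of
degree `n - 1`; call the latter value `c`. Then `h = c g` with `g` monic of degree `n - 2`, `g`
again divides `q(v) - X`, and `q(v(0)) = c p(0) g(0)`, so the claim for `g` gives it for `p`.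

Two moves produce these units: `exists_separable` replaces `v` by `v + p w` to reach a polynomial
with separable reduction, and `exists_isUnit_coeff` then changes the generator. All choices are
generic over the infinite residue field, so it suffices that the polynomial conditions do not vanish
identically. For the changes of generator this is checked over an algebraic closure
(`exists_generatorTest_ne_zero`, `exists_coeffTest_ne_zero`). -/

/-- The quadratic form `x ↦ ∑ i j, a i j * x i * x j` attached to a matrix `a`. -/
def matrixForm {A ι : Type*} [CommRing A] [Fintype ι] (a : Matrix ι ι A) (x : ι → A) : A :=
  x ⬝ᵥ a *ᵥ x

/-! ### Quadratic forms on vectors of polynomials -/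

section MatrixForm

variable {A B ι : Type*} [CommRing A] [CommRing B] [Fintype ι]

theorem map_dotProduct_mulVec (f : A →+* B) (a : Matrix ι ι A) (x y : ι → A) :
    f (x ⬝ᵥ a *ᵥ y) = (f ∘ x) ⬝ᵥ a.map f *ᵥ (f ∘ y) := by
  rw [RingHom.map_dotProduct]
  congr 1
  ext i
  exact RingHom.map_mulVec f a y i

theorem matrixForm_map (f : A →+* B) (a : Matrix ι ι A) (x : ι → A) :
    matrixForm (a.map f) (f ∘ x) = f (matrixForm a x) :=
  (map_dotProduct_mulVec f a x x).symm

theorem matrixForm_smul (a : Matrix ι ι A) (r : A) (x : ι → A) :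
    matrixForm a (r • x) = r ^ 2 * matrixForm a x := by
  simp only [matrixForm, mulVec_smul, dotProduct_smul, smul_dotProduct, smul_eq_mul]
  ring

theorem matrixForm_add {a : Matrix ι ι A} (ha : a.IsSymm) (x y : ι → A) :
    matrixForm a (x + y) = matrixForm a x + 2 * (x ⬝ᵥ a *ᵥ y) + matrixForm a y := by
  have h : y ⬝ᵥ a *ᵥ x = x ⬝ᵥ a *ᵥ y := by
    rw [dotProduct_mulVec, ← mulVec_transpose, ha.eq, dotProduct_comm]
  simp only [matrixForm, mulVec_add, dotProduct_add, add_dotProduct, h]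
  ring

theorem matrixForm_eq_sum (a : Matrix ι ι A) (x : ι → A) :
    matrixForm a x = ∑ i, ∑ j, a i j * x i * x j := by
  simp only [matrixForm, dotProduct, mulVec, Finset.mul_sum]
  exact Finset.sum_congr rfl fun i _ => Finset.sum_congr rfl fun j _ => by ring

/-- Evaluation of the form at a polynomial vector. -/
theorem eval_matrixForm (a : Matrix ι ι A) (v : ι → A[X]) (r : A) :
    (matrixForm (a.map C) v).eval r = matrixForm a fun l => (v l).eval r := by
  have := matrixForm_map (evalRingHom r) (a.map C) v
  rw [coe_evalRingHom] at this
  rw [← this]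
  congr 1
  ext i j
  simp

theorem map_matrixForm (f : A →+* B) (a : Matrix ι ι A) (v : ι → A[X]) :
    (matrixForm (a.map C) v).map f = matrixForm ((a.map f).map C) fun l => (v l).map f := by
  have := matrixForm_map (mapRingHom f) (a.map C) v
  rw [coe_mapRingHom] at this
  rw [← this]
  congr 1
  ext i j
  simp

theorem natDegree_matrixForm_le (a : Matrix ι ι A) {v : ι → A[X]} {d : ℕ}
    (hv : ∀ l, (v l).natDegree ≤ d) : (matrixForm (a.map C) v).natDegree ≤ 2 * d := by
  rw [matrixForm_eq_sum]
  refine natDegree_sum_le_of_forall_le _ _ fun i _ =>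
    natDegree_sum_le_of_forall_le _ _ fun j _ => ?_
  rw [map_apply, mul_assoc, two_mul]
  exact (natDegree_C_mul_le _ _).trans (natDegree_mul_le_of_le (hv i) (hv j))

theorem coeff_matrixForm (a : Matrix ι ι A) {v : ι → A[X]} {d : ℕ}
    (hv : ∀ l, (v l).natDegree ≤ d) :
    (matrixForm (a.map C) v).coeff (2 * d) = matrixForm a fun l => (v l).coeff d := by
  simp only [matrixForm_eq_sum, finsetSum_coeff]
  refine Finset.sum_congr rfl fun i _ => Finset.sum_congr rfl fun j _ => ?_
  rw [map_apply, mul_assoc, coeff_C_mul, two_mul, coeff_mul_add_eq_of_natDegree_le (hv i) (hv j),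
    mul_assoc]

theorem dvd_matrixForm_sub {p : A[X]} (a : Matrix ι ι A[X]) {v w : ι → A[X]}
    (h : ∀ l, p ∣ v l - w l) : p ∣ matrixForm a v - matrixForm a w := by
  simp only [matrixForm_eq_sum, ← Finset.sum_sub_distrib]
  refine Finset.dvd_sum fun i _ => Finset.dvd_sum fun j _ => ?_
  have : a i j * v i * v j - a i j * w i * w j =
      a i j * v i * (v j - w j) + a i j * w j * (v i - w i) := by ring
  rw [this]
  exact dvd_add ((h j).mul_left _) ((h i).mul_left _)

end MatrixForm

/-! ### Generators and norms modulo a monic polynomial -/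

section PowerMatrix

variable {A B : Type*} [CommRing A] [CommRing B] {n : ℕ}

/-- The coefficients of the powers `T ^ j` modulo `p`. -/
noncomputable def powerMatrix (n : ℕ) (p T : A[X]) : Matrix (Fin n) (Fin n) A :=
  .of fun j i => (T ^ (j : ℕ) %ₘ p).coeff i

/-- The coefficients of the products `T * X ^ j` modulo `p`. -/
noncomputable def mulMatrix (n : ℕ) (p T : A[X]) : Matrix (Fin n) (Fin n) A :=
  .of fun i j => ((T * X ^ (j : ℕ)) %ₘ p).coeff i

/-- Up to the factor `det (powerMatrix n p T)`, the coefficients of `u` modulo `p` with respect to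
the powers of `T`. -/
noncomputable def powerCoeff (n : ℕ) (p T u : A[X]) : Fin n → A :=
  (fun i : Fin n => (u %ₘ p).coeff i) ᵥ* (powerMatrix n p T).adjugate

theorem powerMatrix_map (f : A →+* B) {p : A[X]} (hp : p.Monic) (T : A[X]) :
    powerMatrix n (p.map f) (T.map f) = (powerMatrix n p T).map f := by
  ext j i
  simp [powerMatrix, ← Polynomial.map_pow, ← Polynomial.map_modByMonic f hp]

theorem mulMatrix_map (f : A →+* B) {p : A[X]} (hp : p.Monic) (T : A[X]) :
    mulMatrix n (p.map f) (T.map f) = (mulMatrix n p T).map f := by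
  ext j i
  have : T.map f * X ^ (i : ℕ) = (T * X ^ (i : ℕ)).map f := by simp
  rw [mulMatrix, of_apply, this, ← Polynomial.map_modByMonic f hp, coeff_map]
  rfl

theorem powerCoeff_map (f : A →+* B) {p : A[X]} (hp : p.Monic) (T u : A[X]) :
    powerCoeff n (p.map f) (T.map f) (u.map f) = f ∘ powerCoeff n p T u := by
  have h : (powerMatrix n (p.map f) (T.map f)).adjugate = (powerMatrix n p T).adjugate.map f := by
    rw [powerMatrix_map f hp]
    exact (RingHom.map_adjugate f _).symm
  ext i
  rw [Function.comp_apply, powerCoeff, powerCoeff, RingHom.map_vecMul, h,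
    ← Polynomial.map_modByMonic f hp]
  simp only [coeff_map]
  rfl

theorem vecMul_powerMatrix {p : A[X]} (T : A[X]) (c : Fin n → A) (i : Fin n) :
    (c ᵥ* powerMatrix n p T) i = ((∑ j, C (c j) * T ^ (j : ℕ)) %ₘ p).coeff i := by
  have : (∑ j, C (c j) * T ^ (j : ℕ)) %ₘ p = ∑ j, C (c j) * (T ^ (j : ℕ) %ₘ p) := by
    have := map_sum (modByMonicHom p) (fun j => C (c j) * T ^ (j : ℕ)) Finset.univ
    simp only [← smul_eq_C_mul, map_smul, modByMonicHom_apply] at this ⊢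
    exact this
  simp [this, vecMul, dotProduct, powerMatrix]

/-- The adjugate replaces the inverse so that the coordinates stay polynomial in the data, even
where `T` is not a generator; the price is the factor `det`. -/
theorem powerCoeff_eq {p : A[X]} (T u : A[X]) (c : Fin n → A)
    (h : (∑ j, C (c j) * T ^ (j : ℕ)) %ₘ p = u %ₘ p) :
    powerCoeff n p T u = (powerMatrix n p T).det • c := by
  have : (fun i : Fin n => (u %ₘ p).coeff i) = c ᵥ* powerMatrix n p T := by
    ext i
    rw [vecMul_powerMatrix, h]
  rw [powerCoeff, this, vecMul_vecMul, mul_adjugate, vecMul_smul, vecMul_one]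

theorem dvd_of_coeff_modByMonic [Nontrivial A] {p u : A[X]} (hp : p.Monic)
    (hn : p.natDegree = n) (h : ∀ i : Fin n, (u %ₘ p).coeff i = 0) : p ∣ u := by
  rw [← modByMonic_eq_zero_iff_dvd hp]
  ext i
  rw [coeff_zero]
  by_cases hi : i < n
  · exact h ⟨i, hi⟩
  · refine coeff_eq_zero_of_degree_lt ((degree_modByMonic_lt _ hp).trans_le ?_)
    rw [degree_eq_natDegree hp.ne_zero, hn]
    exact_mod_cast not_lt.mp hi

theorem eq_zero_of_dvd_sum {p : A[X]} (hp : p.Monic) (T : A[X])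
    (hT : IsUnit (powerMatrix n p T).det) (c : Fin n → A)
    (h : p ∣ ∑ j, C (c j) * T ^ (j : ℕ)) : c = 0 := by
  have h0 : c ᵥ* powerMatrix n p T = 0 := by
    ext i
    rw [vecMul_powerMatrix, (modByMonic_eq_zero_iff_dvd hp).2 h]
    simp
  have := congrArg (· ᵥ* (powerMatrix n p T)⁻¹) h0
  simpa [vecMul_vecMul, mul_nonsing_inv _ hT] using this

theorem exists_dvd_sum_sub [Nontrivial A] {p : A[X]} (hp : p.Monic) (hn : p.natDegree = n)
    (T u : A[X]) (hT : IsUnit (powerMatrix n p T).det) :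
    ∃ c : Fin n → A, p ∣ (∑ j, C (c j) * T ^ (j : ℕ)) - u := by
  refine ⟨(fun i : Fin n => (u %ₘ p).coeff i) ᵥ* (powerMatrix n p T)⁻¹,
    dvd_of_coeff_modByMonic hp hn fun i => ?_⟩
  rw [sub_modByMonic, coeff_sub, ← vecMul_powerMatrix, vecMul_vecMul, nonsing_inv_mul _ hT,
    vecMul_one, sub_self]

/-- A determinant of remainders commutes with every change of rings, so the norm can be specialised.
-/
theorem norm_mk_eq_det {p : A[X]} (hp : p.Monic) (hn : p.natDegree = n) (T : A[X]) :
    Algebra.norm A (AdjoinRoot.mk p T) = (mulMatrix n p T).det := by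
  subst hn
  rw [Algebra.norm_eq_matrix_det (AdjoinRoot.powerBasisAux' hp)]
  congr 1
  ext i j
  have h : AdjoinRoot.powerBasisAux' hp j = AdjoinRoot.mk p (X ^ (j : ℕ)) := by
    rw [map_pow, AdjoinRoot.mk_X]
    exact (AdjoinRoot.powerBasis' hp).basis_eq_pow j
  rw [Algebra.leftMulMatrix_eq_repr_mul, h, ← map_mul]
  exact (congrArg (coeff · (i : ℕ)) (AdjoinRoot.modByMonicHom_mk hp _))

theorem isUnit_det_mulMatrix {p : A[X]} (hp : p.Monic) (hn : p.natDegree = n) {T : A[X]}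
    (h : IsCoprime p T) : IsUnit (mulMatrix n p T).det := by
  rw [← norm_mk_eq_det hp hn]
  refine IsUnit.map _ ?_
  obtain ⟨x, y, hxy⟩ := h
  refine IsUnit.of_mul_eq_one_right (AdjoinRoot.mk p y) ?_
  rw [← map_mul, ← map_one (AdjoinRoot.mk p), ← hxy, map_add, map_mul _ x p, AdjoinRoot.mk_self]
  simp

/-- The characteristic polynomial of `T` modulo `p`. -/
theorem exists_monic_dvd_comp [Nontrivial A] {p : A[X]} (hp : p.Monic) (hn : p.natDegree = n)
    (T : A[X]) :
    ∃ P : A[X], P.Monic ∧ P.natDegree = n ∧ p ∣ P.comp T ∧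
      Algebra.norm A (AdjoinRoot.mk p T) = (-1) ^ n * P.eval 0 := by
  subst hn
  let b := AdjoinRoot.powerBasisAux' hp
  refine ⟨(Algebra.leftMulMatrix b (AdjoinRoot.mk p T)).charpoly, charpoly_monic _, ?_, ?_, ?_⟩
  · rw [charpoly_natDegree_eq_dim]
    exact Fintype.card_fin _
  · rw [← AdjoinRoot.mk_eq_zero, ← AdjoinRoot.aeval_eq, aeval_comp, AdjoinRoot.aeval_eq]
    apply Algebra.leftMulMatrix_injective b
    rw [← aeval_algHom_apply, aeval_self_charpoly, map_zero]
  · rw [Algebra.norm_eq_matrix_det b, det_eq_sign_charpoly_coeff, coeff_zero_eq_eval_zero,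
      Fintype.card_fin]

end PowerMatrix

/-! ### Polynomial conditions on a change of generator -/

section Generic

variable {A B ι : Type*} [CommRing A] [CommRing B] [Fintype ι] {n : ℕ}

/-- The polynomial with coefficients `y`. -/
noncomputable def polyOfCoeffs (y : Fin n → A) : A[X] := ∑ i, C (y i) * X ^ (i : ℕ)

theorem polyOfCoeffs_map (f : A →+* B) (y : Fin n → A) :
    (polyOfCoeffs y).map f = polyOfCoeffs (f ∘ y) := by
  simp [polyOfCoeffs, Polynomial.map_sum]

theorem polyOfCoeffs_coeff {Y : A[X]} (hY : Y.degree < n) :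
    polyOfCoeffs (fun i : Fin n => Y.coeff i) = Y := by
  rw [polyOfCoeffs, sum_fin (fun i c => C c * X ^ i) (by simp) hY]
  exact sum_C_mul_X_pow_eq Y

/-- This is a unit if and only if the product of `x` with the square of the polynomial with
coefficients `y` is a unit generating the algebra of polynomials modulo `p`. -/
noncomputable def generatorTest (p x : A[X]) (y : Fin n → A) : A :=
  (powerMatrix n p (x * polyOfCoeffs y ^ 2)).det * (mulMatrix n p (x * polyOfCoeffs y ^ 2)).det

/-- The product of the values of a form at the `j`-th coefficient of the vector
`polyOfCoeffs y • v` with respect to the powers of `X * polyOfCoeffs y ^ 2`, up to squares. -/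
noncomputable def coeffTest (a : Matrix ι ι A) (p : A[X]) (v : ι → A[X]) (j : Fin n)
    (y : Fin n → A) : A :=
  matrixForm a fun l => powerCoeff n p (X * polyOfCoeffs y ^ 2) (polyOfCoeffs y * v l) j

/-- Naturality allows the test to be formed once with indeterminates for `y`, then specialised both
to `R` and to the closure of its residue field. -/
theorem generatorTest_map (f : A →+* B) {p : A[X]} (hp : p.Monic) (x : A[X]) (y : Fin n → A) :
    generatorTest (p.map f) (x.map f) (f ∘ y) = f (generatorTest p x y) := by
  rw [generatorTest, generatorTest, ← polyOfCoeffs_map, ← Polynomial.map_pow,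
    ← Polynomial.map_mul, powerMatrix_map f hp, mulMatrix_map f hp, map_mul, RingHom.map_det,
    RingHom.map_det]
  rfl

theorem coeffTest_map (f : A →+* B) (a : Matrix ι ι A) {p : A[X]} (hp : p.Monic) (v : ι → A[X])
    (j : Fin n) (y : Fin n → A) :
    coeffTest (a.map f) (p.map f) (fun l => (v l).map f) j (f ∘ y) = f (coeffTest a p v j y) := by
  rw [coeffTest, coeffTest, ← matrixForm_map]
  congr 1
  ext l
  have := congrFun (powerCoeff_map (n := n) f hp (X * polyOfCoeffs y ^ 2) (polyOfCoeffs y * v l)) j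
  simpa only [Polynomial.map_mul, Polynomial.map_pow, map_X, polyOfCoeffs_map,
    Function.comp_apply] using this

end Generic

/-- A value that is nonzero over an extension of the residue field shows that the reduction of `F`
is a nonzero polynomial. Over an infinite field it is then nonzero at a rational point, and any lift
of that point works. -/
theorem exists_isUnit_eval {R σ K : Type*} [CommRing R] [IsLocalRing R]
    [Infinite (IsLocalRing.ResidueField R)] [Field K] (φ : IsLocalRing.ResidueField R →+* K)
    (F : MvPolynomial σ R) (y₀ : σ → K)
    (h : MvPolynomial.eval₂ (φ.comp (IsLocalRing.residue R)) y₀ F ≠ 0) :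
    ∃ y : σ → R, IsUnit (MvPolynomial.eval y F) := by
  have hF : MvPolynomial.map (IsLocalRing.residue R) F ≠ 0 := by
    intro h0
    apply h
    rw [← MvPolynomial.eval₂_map, h0, MvPolynomial.eval₂_zero]
  obtain ⟨w, hw⟩ : ∃ w, MvPolynomial.eval w (MvPolynomial.map (IsLocalRing.residue R) F) ≠ 0 := by
    by_contra! h0
    exact hF (MvPolynomial.funext fun w => by rw [h0, map_zero])
  choose y hy using fun i => IsLocalRing.residue_surjective (w i)
  refine ⟨y, ?_⟩
  rw [← IsLocalRing.residue_ne_zero_iff_isUnit]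
  convert hw
  rw [MvPolynomial.eval_map, ← MvPolynomial.eval₂_id, MvPolynomial.hom_eval₂]
  congr 1
  exact funext hy

theorem exists_eval_algebraMap_ne_zero {k K σ : Type*} [Field k] [Infinite k] [Field K]
    [Algebra k K] {G : MvPolynomial σ K} (hG : G ≠ 0) :
    ∃ w : σ → k, MvPolynomial.eval (algebraMap k K ∘ w) G ≠ 0 := by
  by_contra! h
  refine hG (MvPolynomial.funext_set (fun _ => Set.range (algebraMap k K))
    (fun _ => Set.infinite_range_of_injective (algebraMap k K).injective) fun x hx => ?_)
  choose w hw using fun i => hx i (Set.mem_univ i)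
  rw [map_zero, ← h w]
  congr 2
  exact (funext hw).symm

/-! ### Nonvanishing over an algebraically closed field -/

section AlgClosed

variable {K : Type*} [Field K]

/-- Roots are added one at a time, multiplicities included: a square root `y` modulo `p'` is
corrected to `y + t p'` modulo `(X - r) p'`. -/
theorem exists_dvd_sq_sub [IsAlgClosed K] (h2 : (2 : K) ≠ 0) {p u : K[X]} (hp : p.Monic)
    (hu : IsCoprime p u) : ∃ y, p ∣ y ^ 2 - u := by
  have hsplit := (IsAlgClosed.splits p).eq_prod_roots_of_monic hp
  generalize p.roots = s at hsplit
  induction s using Multiset.induction generalizing p with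
  | empty => exact ⟨0, by simp [hsplit]⟩
  | cons r s ih =>
    obtain ⟨p', hp'⟩ : ∃ p', p' = (s.map fun r => X - C r).prod := ⟨_, rfl⟩
    have hpp : p = (X - C r) * p' := by rw [hsplit, Multiset.map_cons, Multiset.prod_cons, hp']
    have hp'm : p'.Monic := hp' ▸ monic_multisetProd_X_sub_C s
    obtain ⟨y, e, he⟩ := ih hp'm (by rw [hpp] at hu; exact hu.of_mul_left_right) hp'
    have hur : u.eval r ≠ 0 := by
      obtain ⟨b, c, hbc⟩ := hu
      intro h0
      have := congrArg (eval r) hbc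
      simp [hpp, h0] at this
    -- At a repeated root the equation for `t` is linear, with `y(r)² = u(r) ≠ 0`; otherwise it is a
    -- genuine quadratic.
    obtain ⟨t, ht⟩ : ∃ t : K, e.eval r + 2 * t * y.eval r + t ^ 2 * p'.eval r = 0 := by
      by_cases hr : p'.eval r = 0
      · have hy : y.eval r ≠ 0 := by
          intro h0
          have := congrArg (eval r) he
          simp [hr, h0, hur] at this
        exact ⟨-e.eval r / (2 * y.eval r), by rw [hr]; field_simp; ring⟩
      · have hd : (C (p'.eval r) * X ^ 2 + C (2 * y.eval r) * X + C (e.eval r)).degree ≠ 0 := by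
          rw [degree_quadratic hr]
          decide
        obtain ⟨t, ht⟩ := IsAlgClosed.exists_root _ hd
        refine ⟨t, ?_⟩
        simp only [IsRoot.def, eval_add, eval_mul, eval_C, eval_pow, eval_X] at ht
        linear_combination ht
    have hdvd : X - C r ∣ e + C (2 * t) * y + C (t ^ 2) * p' := by
      rw [dvd_iff_isRoot, IsRoot.def]
      simp only [eval_add, eval_mul, eval_C]
      linear_combination ht
    refine ⟨y + C t * p', ?_⟩
    have : (y + C t * p') ^ 2 - u = (e + C (2 * t) * y + C (t ^ 2) * p') * p' := by
      simp only [C_mul, C_pow, C_ofNat]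
      linear_combination he
    rw [this, hpp]
    exact mul_dvd_mul_right hdvd _

/-- Taking `y` with `y² ≡ X x⁻¹` modulo `p` makes `x y² ≡ X`, which generates the algebra and is a
unit because `p(0) ≠ 0`. Separability plays no role. -/
theorem exists_generatorTest_ne_zero [IsAlgClosed K] (h2 : (2 : K) ≠ 0) {n : ℕ} {p x : K[X]}
    (hp : p.Monic) (hn : p.natDegree = n) (hx : IsCoprime p x) (h0 : p.eval 0 ≠ 0) :
    ∃ y : Fin n → K, generatorTest p x y ≠ 0 := by
  obtain ⟨b, c, hbc⟩ := id hx
  have hX : IsCoprime p X := by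
    rw [isCoprime_comm, (irreducible_X (R := K)).coprime_iff_not_dvd, X_dvd_iff,
      coeff_zero_eq_eval_zero]
    exact h0
  have hc : IsCoprime p c := ⟨b, x, by linear_combination hbc⟩
  obtain ⟨y, hy⟩ := exists_dvd_sq_sub h2 hp (hX.mul_right hc)
  have hYdeg : (y %ₘ p).degree < n := by
    have := degree_modByMonic_lt y hp
    rwa [degree_eq_natDegree hp.ne_zero, hn] at this
  refine ⟨fun i => (y %ₘ p).coeff i, ?_⟩
  rw [generatorTest, polyOfCoeffs_coeff hYdeg]
  obtain ⟨T, hT⟩ : ∃ T, T = x * (y %ₘ p) ^ 2 := ⟨_, rfl⟩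
  have hTX : p ∣ T - X := by
    obtain ⟨e, he⟩ := hy
    have h1 : y %ₘ p = y - p * (y /ₘ p) := modByMonic_eq_sub_mul_div y p
    refine ⟨x * e - 2 * x * y * (y /ₘ p) + x * p * (y /ₘ p) ^ 2 - b * X, ?_⟩
    rw [hT, h1]
    linear_combination x * he + X * hbc
  rw [← hT]
  have hTc : IsCoprime p T := by
    obtain ⟨e, he⟩ := hTX
    have : T = X + p * e := by linear_combination he
    rw [this]
    exact hX.add_mul_left_right e
  refine mul_ne_zero ?_ (isUnit_det_mulMatrix hp hn hTc).ne_zero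
  have : powerMatrix n p T = 1 := by
    ext j i
    have h1 : T ^ (j : ℕ) %ₘ p = X ^ (j : ℕ) := by
      have h2 : p ∣ T ^ (j : ℕ) - X ^ (j : ℕ) := hTX.trans (sub_dvd_pow_sub_pow _ _ _)
      rw [← modByMonic_eq_zero_iff_dvd hp, sub_modByMonic, sub_eq_zero] at h2
      rw [h2, modByMonic_eq_self_iff hp, degree_X_pow, degree_eq_natDegree hp.ne_zero, hn]
      exact_mod_cast j.2
    rw [powerMatrix, of_apply, h1, coeff_X_pow, one_apply]
    simp [Fin.ext_iff, eq_comm]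
  rw [this, det_one]
  exact one_ne_zero

variable {ι : Type*} [Fintype ι]

/-- Over a split separable algebra this is the required change of generator: the `s i` are the
values of `Y` at the roots. Points are added one by one, and a generic scaling `t` of the new point
works. -/
theorem exists_interpolation [Infinite K] (a : Matrix ι ι K) (n : ℕ) (x : Fin (n + 1) → K)
    (z : Fin (n + 1) → ι → K) (hx : ∀ i, x i ≠ 0) (hz : ∀ i, matrixForm a (z i) ≠ 0) :
    ∃ (s : Fin (n + 1) → K) (u : ι → K[X]), (∀ i, s i ≠ 0) ∧
      Function.Injective (fun i => x i * s i ^ 2) ∧ (∀ l, (u l).natDegree ≤ n) ∧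
      (∀ i l, (u l).eval (x i * s i ^ 2) = s i * z i l) ∧
      matrixForm a (fun l => (u l).eval 0) ≠ 0 ∧
      (n ≠ 0 → matrixForm a (fun l => (u l).coeff n) ≠ 0) := by
  induction n with
  | zero =>
    have : Subsingleton (Fin (0 + 1)) := inferInstanceAs (Subsingleton (Fin 1))
    refine ⟨fun _ => 1, fun l => C (z 0 l), by simp, Function.injective_of_subsingleton _,
      by simp, fun i l => ?_, by simpa using hz 0, by simp⟩
    rw [Subsingleton.elim i 0]
    simp
  | succ n ih =>
    obtain ⟨s, u, hs, hinj, hdeg, hu, hu0, -⟩ :=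
      ih (fun i => x i.succ) (fun i => z i.succ) (fun i => hx _) (fun i => hz _)
    obtain ⟨g, hg⟩ : ∃ g : K[X], g = ∏ i, (X - C (x i.succ * s i ^ 2)) := ⟨_, rfl⟩
    have hgm : g.Monic := hg ▸ monic_prod_X_sub_C _ _
    have hgd : g.natDegree = n + 1 := by rw [hg, natDegree_finsetProd_X_sub_C_eq_card]; simp
    have hg0 : g.eval 0 ≠ 0 := by
      rw [hg, eval_prod, Finset.prod_ne_zero_iff]
      intro i _
      simpa using ⟨hx _, hs i⟩
    have hgr (i) : g.eval (x i.succ * s i ^ 2) = 0 := by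
      rw [hg, eval_prod]
      exact Finset.prod_eq_zero (Finset.mem_univ i) (by simp)
    -- The correction `g E(t) / g(x₀ t²)` keeps the old values and fixes the new one. Its top
    -- coefficient is proportional to `E(t)`, and `E(0) = -u(0)` is anisotropic by induction.
    obtain ⟨E, hE⟩ : ∃ E : ι → K[X], E = fun l => C (z 0 l) * X - (u l).comp (C (x 0) * X ^ 2) :=
      ⟨_, rfl⟩
    -- The new value at `0` is proportional to `t H(t)`. The factor `t` is divided out because only
    -- `H(0) = g(0) z₀` is visibly anisotropic.
    obtain ⟨H, hH⟩ : ∃ H : ι → K[X], H = fun l =>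
        C ((u l).eval 0) * (C (x 0) * X * (divX g).comp (C (x 0) * X ^ 2)) +
        C (g.eval 0) * (C (z 0 l) - C (x 0) * X * (divX (u l)).comp (C (x 0) * X ^ 2)) := ⟨_, rfl⟩
    have hEH (t : K) (l : ι) : (u l).eval 0 * g.eval (x 0 * t ^ 2) + g.eval 0 * (E l).eval t =
        t * (H l).eval t := by
      have h1 := congrArg (eval (x 0 * t ^ 2)) (divX_mul_X_add g)
      have h2 := congrArg (eval (x 0 * t ^ 2)) (divX_mul_X_add (u l))
      simp only [eval_add, eval_mul, eval_X, eval_C, coeff_zero_eq_eval_zero] at h1 h2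
      simp only [hE, hH, eval_sub, eval_add, eval_mul, eval_X, eval_C, eval_comp, eval_pow]
      rw [← h1, ← h2]
      ring
    obtain ⟨t, ht⟩ : ∃ t, (X * matrixForm (a.map C) E * matrixForm (a.map C) H *
        g.comp (C (x 0) * X ^ 2)).eval t ≠ 0 := by
      by_contra! h
      have hz' : X * matrixForm (a.map C) E * matrixForm (a.map C) H *
        g.comp (C (x 0) * X ^ 2) = 0 := Polynomial.funext fun t => by rw [h, eval_zero]
      revert hz'
      refine mul_ne_zero (mul_ne_zero (mul_ne_zero X_ne_zero ?_) ?_) ?_ <;>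
        intro h0 <;> replace h0 := congrArg (eval 0) h0
      · have h1 : (fun l => (E l).eval 0) = (-1 : K) • fun l => (u l).eval 0 := by
          ext l
          simp [hE]
        rw [eval_matrixForm, h1, matrixForm_smul] at h0
        simp [hu0] at h0
      · have h1 : (fun l => (H l).eval 0) = g.eval 0 • z 0 := by
          ext l
          simp [hH]
        rw [eval_matrixForm, h1, matrixForm_smul] at h0
        simp [hg0, hz 0] at h0
      · simp [hg0] at h0
    simp only [eval_mul, eval_X, eval_comp, eval_C, eval_pow, eval_matrixForm, mul_ne_zero_iff]
      at ht
    obtain ⟨⟨⟨ht0, htE⟩, htH⟩, htg⟩ := ht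
    refine ⟨Fin.cons t s, fun l => u l + g * C ((E l).eval t / g.eval (x 0 * t ^ 2)), ?_, ?_, ?_,
      ?_, ?_, ?_⟩
    · exact Fin.cases ht0 hs
    · have hne (i) : x 0 * t ^ 2 ≠ x i.succ * s i ^ 2 := fun h => htg (by rw [h, hgr])
      intro i j
      refine Fin.cases ?_ (fun i => ?_) i <;> refine Fin.cases ?_ (fun j => ?_) j <;>
        simp only [Fin.cons_zero, Fin.cons_succ]
      · simp
      · exact fun h => absurd h (hne j)
      · exact fun h => absurd h.symm (hne i)
      · exact fun h => congrArg _ (hinj h)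
    · intro l
      exact natDegree_add_le_of_degree_le ((hdeg l).trans n.le_succ)
        ((natDegree_mul_C_le _ _).trans hgd.le)
    · refine Fin.cases (fun l => ?_) (fun i l => ?_)
      · simp only [Fin.cons_zero, eval_add, eval_mul, eval_C]
        rw [mul_div_cancel₀ _ htg]
        simp only [hE, eval_sub, eval_mul, eval_C, eval_X, eval_comp, eval_pow]
        ring
      · simp only [Fin.cons_succ, eval_add, eval_mul, hgr, hu]
        simp
    · have h1 : (fun l => (u l + g * C ((E l).eval t / g.eval (x 0 * t ^ 2))).eval 0) =
          (t / g.eval (x 0 * t ^ 2)) • fun l => (H l).eval t := by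
        ext l
        have := hEH t l
        simp only [eval_add, eval_mul, eval_C, Pi.smul_apply, smul_eq_mul]
        field_simp
        linear_combination this
      rw [h1, matrixForm_smul]
      exact mul_ne_zero (pow_ne_zero _ (div_ne_zero ht0 htg)) htH
    · intro _
      have h1 : (fun l => (u l + g * C ((E l).eval t / g.eval (x 0 * t ^ 2))).coeff (n + 1)) =
          (1 / g.eval (x 0 * t ^ 2)) • fun l => (E l).eval t := by
        ext l
        have h2 : g.coeff (n + 1) = 1 := hgd ▸ hgm.coeff_natDegree
        rw [coeff_add, coeff_mul_C, h2,
          coeff_eq_zero_of_natDegree_lt (Nat.lt_succ_of_le (hdeg l))]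
        simp [div_eq_inv_mul]
      rw [h1, matrixForm_smul]
      exact mul_ne_zero (pow_ne_zero _ (one_div_ne_zero htg)) htE

/-- Evaluation at the distinct roots `r i` of `p` turns congruences modulo `p` into interpolation.
With `Y(r i) = s i`, the interpolating vector satisfies `u(T) ≡ Y v`, so its coefficients are the
coordinates being tested. -/
theorem exists_coeffTest_ne_zero [IsAlgClosed K] (a : Matrix ι ι K) {n : ℕ} {p : K[X]}
    (hp : p.Monic) (hn : p.natDegree = n + 2) (hsep : p.Separable) (h0 : p.eval 0 ≠ 0)
    {v : ι → K[X]} (hv : p ∣ matrixForm (a.map C) v - X) :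
    ∃ y : Fin (n + 2) → K, generatorTest p X y * coeffTest a p v 0 y *
      coeffTest a p v (Fin.last _) y ≠ 0 := by
  classical
  have : Infinite K := IsAlgClosed.instInfinite
  have hcard : p.roots.toFinset.card = n + 2 := by
    rw [Multiset.toFinset_card_of_nodup (nodup_roots hsep), ← hn]
    exact (IsAlgClosed.splits p).natDegree_eq_card_roots.symm
  let e := (Finset.equivFinOfCardEq hcard).symm
  obtain ⟨r, hr⟩ : ∃ r : Fin (n + 2) → K, r = fun i => (e i : K) := ⟨_, rfl⟩
  have hrinj : Function.Injective r := hr ▸ Subtype.val_injective.comp e.injective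
  have hroot (i) : p.eval (r i) = 0 := by
    have := (e i).2
    rw [Multiset.mem_toFinset, mem_roots hp.ne_zero] at this
    rw [hr]
    exact this
  have hprod : p = ∏ i, (X - C (r i)) := by
    rw [(IsAlgClosed.splits p).eq_prod_roots_of_monic hp, hr, e.prod_comp fun c => X - C (c : K),
      Finset.prod_coe_sort _ fun c => X - C c, Finset.prod,
      Multiset.toFinset_val, (nodup_roots hsep).dedup]
  have hdvd {f : K[X]} (hf : ∀ i, f.eval (r i) = 0) : p ∣ f := by
    rw [hprod]
    exact Finset.prod_dvd_of_coprime (fun i _ j _ hij => pairwise_coprime_X_sub_C hrinj hij)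
      fun i _ => dvd_iff_isRoot.2 (hf i)
  have hvr (i) : matrixForm a (fun l => (v l).eval (r i)) = r i := by
    obtain ⟨f, hf⟩ := hv
    have := congrArg (eval (r i)) hf
    rw [eval_sub, eval_matrixForm, eval_mul, hroot, zero_mul, eval_X, sub_eq_zero] at this
    exact this
  have hr0 (i) : r i ≠ 0 := fun h => h0 (h ▸ hroot i)
  obtain ⟨s, u, hs, hinj, hdeg, hu, hu0, hun⟩ := exists_interpolation a (n + 1) r
    (fun i l => (v l).eval (r i)) hr0 (fun i => by rw [hvr]; exact hr0 i)
  obtain ⟨Y, hY⟩ : ∃ Y, Y = Lagrange.interpolate Finset.univ r s := ⟨_, rfl⟩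
  have hYdeg : Y.degree < (n + 2 : ℕ) := by
    have := Lagrange.degree_interpolate_lt (s := Finset.univ) s hrinj.injOn
    rw [Finset.card_univ, Fintype.card_fin] at this
    exact hY ▸ this
  have hYr (i) : Y.eval (r i) = s i :=
    hY ▸ Lagrange.eval_interpolate_at_node s hrinj.injOn (Finset.mem_univ i)
  obtain ⟨T, hT⟩ : ∃ T, T = X * Y ^ 2 := ⟨_, rfl⟩
  have hTr (i) : T.eval (r i) = r i * s i ^ 2 := by simp [hT, hYr]
  have hTc : IsCoprime p T := by
    rw [hprod]
    refine IsCoprime.prod_left fun i _ => ?_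
    rw [(irreducible_X_sub_C _).coprime_iff_not_dvd, dvd_iff_isRoot, IsRoot.def, hTr]
    exact mul_ne_zero (hr0 i) (pow_ne_zero _ (hs i))
  -- Vandermonde argument: a relation among the powers of `T` is a polynomial of degree at most `n +
  -- 1` with `n + 2` distinct zeros `r i * s i ^ 2`.
  have hV : (powerMatrix (n + 2) p T).det ≠ 0 := by
    intro hdet
    obtain ⟨c, hc0, hc⟩ := exists_vecMul_eq_zero_iff.2 hdet
    have h1 : p ∣ ∑ j, C (c j) * T ^ (j : ℕ) :=
      dvd_of_coeff_modByMonic hp hn fun i => by rw [← vecMul_powerMatrix, hc, Pi.zero_apply]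
    have h2 : polyOfCoeffs c = 0 := by
      refine eq_zero_of_natDegree_lt_card_of_eval_eq_zero _ hinj (fun i => ?_) ?_
      · obtain ⟨f, hf⟩ := h1
        have := congrArg (eval (r i)) hf
        simpa [eval_finsetSum, hTr, hroot, polyOfCoeffs] using this
      · rw [Fintype.card_fin]
        refine (natDegree_sum_le_of_forall_le (n := n + 1) _ _ fun i _ => ?_).trans_lt
          (Nat.lt_succ_self _)
        exact (natDegree_C_mul_X_pow_le _ _).trans (Nat.lt_succ_iff.1 i.2)
    apply hc0
    ext i
    have := congrArg (coeff · (i : ℕ)) h2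
    simpa [polyOfCoeffs, finsetSum_coeff, coeff_X_pow, Fin.val_inj] using this
  have hcoeff (l) : powerCoeff (n + 2) p T (Y * v l) =
      (powerMatrix (n + 2) p T).det • fun j : Fin (n + 2) => (u l).coeff j := by
    apply powerCoeff_eq
    rw [← sub_eq_zero, ← sub_modByMonic, modByMonic_eq_zero_iff_dvd hp]
    refine hdvd fun i => ?_
    have h1 := eval_eq_sum_range' (Nat.lt_succ_of_le (hdeg l)) (r i * s i ^ 2)
    rw [Finset.sum_range, hu] at h1
    simp [eval_finsetSum, hTr, hYr, h1]
  refine ⟨fun i => Y.coeff i, ?_⟩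
  rw [generatorTest, coeffTest, coeffTest, polyOfCoeffs_coeff hYdeg, ← hT]
  have hform (j : Fin (n + 2)) (hj : matrixForm a (fun l => (u l).coeff j) ≠ 0) :
      matrixForm a (fun l => powerCoeff (n + 2) p T (Y * v l) j) ≠ 0 := by
    have : (fun l => powerCoeff (n + 2) p T (Y * v l) j) =
        (powerMatrix (n + 2) p T).det • fun l => (u l).coeff j := by
      ext l
      rw [hcoeff]
      rfl
    rw [this, matrixForm_smul]
    exact mul_ne_zero (pow_ne_zero _ hV) hj
  refine mul_ne_zero (mul_ne_zero (mul_ne_zero hV (isUnit_det_mulMatrix hp hn hTc).ne_zero)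
    (hform 0 ?_)) (hform (Fin.last _) ?_)
  · simpa only [← coeff_zero_eq_eval_zero, Fin.val_zero] using hu0
  · exact hun n.succ_ne_zero

end AlgClosed

/-! ### Separability of a generic deformation -/

theorem coeff_zero_swap {k : Type*} [CommRing k] (f : k[X][X]) :
    (Bivariate.swap f).coeff 0 = f.map (evalRingHom 0) := by
  induction f using Polynomial.induction_on' with
  | add f g hf hg => simp [hf, hg]
  | monomial n f =>
    rw [Bivariate.swap_monomial, mul_coeff_zero, coeff_map, coeff_C_zero, map_monomial,
      coe_evalRingHom, ← coeff_zero_eq_eval_zero, C_mul_X_pow_eq_monomial]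

/-- `d` is the resultant, up to sign the discriminant, of the family over `k[μ]`. If it vanished,
the family would have a square factor `A'²`; at `μ = 0` the factor `A'` would divide both `p` and
the `μ`-derivative `g`, which are coprime. -/
theorem exists_separable_deformation {k : Type*} [Field k] [CharZero k] {n : ℕ} {p g h : k[X]}
    (hp : p.Monic) (hn : p.natDegree = n) (hg : g.natDegree < n) (hh : h.natDegree < n)
    (hpg : IsCoprime p g) :
    ∃ d : k[X], d ≠ 0 ∧ ∀ μ, d.eval μ ≠ 0 → (p + C μ * g + C (μ ^ 2) * h).Separable := by
  have hn0 : n ≠ 0 := by lia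
  obtain ⟨q, hq⟩ : ∃ q : k[X][X], q = C X * g.map C + C (X ^ 2) * h.map C := ⟨_, rfl⟩
  obtain ⟨f, hf⟩ : ∃ f, f = p.map C + q := ⟨_, rfl⟩
  have hpm : (p.map C).natDegree = n := by rw [hp.natDegree_map, hn]
  have hqd : q.natDegree < (p.map C).natDegree := by
    rw [hpm, hq]
    refine lt_of_le_of_lt (natDegree_add_le _ _) (max_lt ?_ ?_)
    · exact (natDegree_C_mul_le _ _).trans_lt (natDegree_map_le.trans_lt hg)
    · exact (natDegree_C_mul_le _ _).trans_lt (natDegree_map_le.trans_lt hh)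
  have hfm : f.Monic := hf ▸ (hp.map C).add_of_left (degree_lt_degree hqd)
  have hfd : f.natDegree = n := by rw [hf, natDegree_add_eq_left_of_natDegree_lt hqd, hpm]
  -- Since `f` is monic and the characteristic is zero, the degrees `n` and `n - 1` survive every
  -- specialisation to a field.
  have key {B : Type _} [Field B] [CharZero B] (φ : k[X] →+* B) :
      φ (resultant f (derivative f) n (n - 1)) = 0 ↔ ¬ (f.map φ).Separable := by
    have h1 : (f.map φ).natDegree = n := by rw [hfm.natDegree_map, hfd]
    have h2 : (derivative f |>.map φ).natDegree = n - 1 := by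
      rw [← derivative_map, natDegree_derivative, h1]
    have h3 := resultant_eq_zero_iff (f := f.map φ) (g := (derivative f).map φ)
    rw [h1, h2, resultant_map_map] at h3
    rw [h3, Separable, derivative_map]
    exact and_iff_right (Or.inl (hfm.map φ).ne_zero)
  refine ⟨resultant f (derivative f) n (n - 1), fun h0 => ?_, fun μ hμ => ?_⟩
  · have hns := (key (algebraMap k[X] (RatFunc k))).1 (by rw [h0, map_zero])
    rw [PerfectField.separable_iff_squarefree, Squarefree] at hns
    push Not at hns
    obtain ⟨A, hA, hAu⟩ := hns
    -- Gauss's lemma brings the repeated factor down from `k(μ)[X]` to `k[μ][X]`.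
    obtain ⟨A', hA'⟩ := IsIntegrallyClosed.eq_map_mul_C_of_dvd (RatFunc k) hfm
      (dvd_of_mul_right_dvd hA)
    have hA0 : A ≠ 0 := by
      rintro rfl
      exact (hfm.map (algebraMap k[X] (RatFunc k))).ne_zero (by simpa using hA)
    have hinj := IsFractionRing.injective k[X] (RatFunc k)
    have hA'm : A'.Monic := by
      refine monic_of_injective hinj ?_
      have := congrArg leadingCoeff hA'
      rw [leadingCoeff_mul, leadingCoeff_C] at this
      exact mul_right_cancel₀ (leadingCoeff_ne_zero.2 hA0) (by rw [this, one_mul])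
    obtain ⟨B, hB⟩ : A' * A' ∣ f := by
      rw [← Polynomial.map_dvd_map _ hinj (hA'm.mul hA'm), Polynomial.map_mul]
      refine (mul_dvd_mul ?_ ?_).trans hA <;> exact ⟨_, hA'.symm⟩
    -- Swapping the variables allows comparison of the coefficients of `μ⁰` and `μ¹`; `h` enters
    -- only at `μ²`.
    have hs := congrArg Bivariate.swap hB
    rw [hf, hq] at hs
    simp only [map_add, map_mul, Bivariate.swap_map_C, Bivariate.swap_X, map_pow] at hs
    have hs0 := congrArg (coeff · 0) hs
    have hs1 := congrArg (coeff · 1) hs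
    simp only [mul_coeff_one, mul_coeff_zero, coeff_add, coeff_zero_swap, coeff_C_zero, coeff_X_zero,
      coeff_X_one, pow_two, coeff_C_succ, zero_mul, mul_zero, add_zero, zero_add, one_mul]
      at hs0 hs1
    have hu : IsUnit (A'.map (evalRingHom 0)) := by
      refine hpg.isUnit_of_dvd' ?_ ?_
      · exact ⟨A'.map (evalRingHom 0) * B.map (evalRingHom 0), by rw [hs0]; ring⟩
      · rw [hs1, mul_comm (coeff _ 1), ← mul_add, mul_assoc, mul_assoc, ← mul_add]
        exact dvd_mul_right _ _
    rw [(hA'm.map _).isUnit_iff] at hu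
    have hA'1 : A' = 1 := by
      refine eq_one_of_monic_natDegree_zero hA'm ?_
      rw [← hA'm.natDegree_map (evalRingHom 0), hu, natDegree_one]
    rw [hA'1, Polynomial.map_one, one_mul] at hA'
    exact hAu (hA' ▸ isUnit_C.2 (leadingCoeff_ne_zero.2 hA0).isUnit)
  · have h1 := not_not.1 (mt (key (evalRingHom μ)).2 hμ)
    have h3 : (evalRingHom μ).comp C = RingHom.id k := by
      ext
      simp
    simpa [hf, hq, Polynomial.map_map, h3, add_assoc] using h1

/-! ### The value group inside the ring, and change of generator -/

section ValueMonoid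

variable {A ι : Type*} [CommRing A] [Fintype ι]

/-- The units of `A` that are products of unit values of a form and of their inverses, as elements
of `A`. -/
def matrixFormValues (a : Matrix ι ι A) : Submonoid A :=
  (Subgroup.closure {u : Aˣ | ∃ x, matrixForm a x = u}).toSubmonoid.map (Units.coeHom A)

theorem matrixForm_mem_values {a : Matrix ι ι A} {x : ι → A} (h : IsUnit (matrixForm a x)) :
    matrixForm a x ∈ matrixFormValues a :=
  ⟨h.unit, Subgroup.subset_closure ⟨x, rfl⟩, rfl⟩

theorem mem_values_of_mul {a : Matrix ι ι A} {r s : A} (hr : r ∈ matrixFormValues a)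
    (hrs : r * s ∈ matrixFormValues a) : s ∈ matrixFormValues a := by
  obtain ⟨u, hu, rfl⟩ := hr
  obtain ⟨w, hw, hws⟩ := hrs
  refine ⟨u⁻¹ * w, Subgroup.mul_mem _ (Subgroup.inv_mem _ hu) hw, ?_⟩
  rw [map_mul, hws, ← mul_assoc, ← map_mul, inv_mul_cancel, map_one, one_mul]

/-- `r²` is the quotient of the values at `r w` and at `w`. -/
theorem sq_mem_values {a : Matrix ι ι A} {w : ι → A} (hw : IsUnit (matrixForm a w)) {r : A}
    (hr : IsUnit r) : r ^ 2 ∈ matrixFormValues a := by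
  refine mem_values_of_mul (matrixForm_mem_values hw) ?_
  rw [mul_comm, ← matrixForm_smul]
  refine matrixForm_mem_values ?_
  rw [matrixForm_smul]
  exact (hr.pow 2).mul hw

theorem matrixForm_comp (a : Matrix ι ι A) (v : ι → A[X]) (T : A[X]) :
    (matrixForm (a.map C) v).comp T = matrixForm (a.map C) fun l => (v l).comp T := by
  have := matrixForm_map (compRingHom T) (a.map C) v
  rw [coe_compRingHom_apply] at this
  rw [← this]
  congr 1
  ext i j
  simp

theorem comp_polyOfCoeffs {n : ℕ} (c : Fin n → A) (T : A[X]) :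
    (polyOfCoeffs c).comp T = ∑ j, C (c j) * T ^ (j : ℕ) := by
  rw [← coe_compRingHom_apply, polyOfCoeffs, map_sum]
  simp

theorem polyOfCoeffs_coeff_fin {n : ℕ} (c : Fin n → A) (j : Fin n) :
    (polyOfCoeffs c).coeff j = c j := by
  simp [polyOfCoeffs, finsetSum_coeff, coeff_X_pow, Fin.val_inj]

theorem natDegree_polyOfCoeffs_le {n : ℕ} (c : Fin n → A) :
    (polyOfCoeffs c).natDegree ≤ n - 1 :=
  natDegree_sum_le_of_forall_le _ _ fun i _ =>
    (natDegree_C_mul_X_pow_le _ _).trans (Nat.le_sub_one_of_lt i.2)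

theorem map_dvd_matrixForm_sub {B : Type*} [CommRing B] (φ : A →+* B) {a : Matrix ι ι A}
    {p x : A[X]} {v : ι → A[X]} (hv : p ∣ matrixForm (a.map C) v - x) :
    p.map φ ∣ matrixForm ((a.map φ).map C) (fun l => (v l).map φ) - x.map φ := by
  rw [← map_matrixForm, ← Polynomial.map_sub]
  exact Polynomial.map_dvd φ hv

theorem matrixForm_eval_root (a : Matrix ι ι A) {p x : A[X]} {v : ι → A[X]}
    (hv : p ∣ matrixForm (a.map C) v - x) {r : A} (hr : p.IsRoot r) :
    matrixForm a (fun l => (v l).eval r) = x.eval r := by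
  obtain ⟨f, hf⟩ := hv
  have := congrArg (eval r) hf
  rwa [eval_sub, eval_matrixForm, eval_mul, hr.eq_zero, zero_mul, sub_eq_zero] at this

/-- If `T = x * Y ^ 2` generates the algebra of polynomials modulo `p`, then `Y • v` can be
expressed through the powers of `T`. -/
theorem exists_change_generator [Nontrivial A] (a : Matrix ι ι A) {n : ℕ} {p : A[X]}
    (hp : p.Monic) (hn : p.natDegree = n) (x Y : A[X]) {v : ι → A[X]}
    (hv : p ∣ matrixForm (a.map C) v - x)
    (hT : IsUnit (powerMatrix n p (x * Y ^ 2)).det) :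
    ∃ (P : A[X]) (u : ι → A[X]), P.Monic ∧ P.natDegree = n ∧
      Algebra.norm A (AdjoinRoot.mk p (x * Y ^ 2)) = (-1) ^ n * P.eval 0 ∧
      (∀ l, (u l).natDegree ≤ n - 1) ∧ P ∣ matrixForm (a.map C) u - X ∧
      ∀ j : Fin n, (fun l => powerCoeff n p (x * Y ^ 2) (Y * v l) j) =
        (powerMatrix n p (x * Y ^ 2)).det • fun l => (u l).coeff j := by
  obtain ⟨T, hTdef⟩ : ∃ T, T = x * Y ^ 2 := ⟨_, rfl⟩
  rw [← hTdef] at hT ⊢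
  obtain ⟨P, hPm, hPn, hPT, hPnorm⟩ := exists_monic_dvd_comp hp hn T
  choose c hc using fun l => exists_dvd_sum_sub hp hn T (Y * v l) hT
  refine ⟨P, fun l => polyOfCoeffs (c l), hPm, hPn, hPnorm,
    fun l => natDegree_polyOfCoeffs_le _, ?_, fun j => ?_⟩
  · obtain ⟨f, hf⟩ : ∃ f, f = matrixForm (a.map C) (fun l => polyOfCoeffs (c l)) - X := ⟨_, rfl⟩
    -- The form at `Y v` is `Y²` times the form at `v`, hence congruent to `Y² x = T`.
    have hfT : p ∣ f.comp T := by
      have h1 : p ∣ matrixForm (a.map C) (fun l => (polyOfCoeffs (c l)).comp T) -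
          matrixForm (a.map C) (Y • v) :=
        dvd_matrixForm_sub _ fun l => by rw [comp_polyOfCoeffs]; exact hc l
      rw [matrixForm_smul] at h1
      have h2 := dvd_add h1 (hv.mul_left (Y ^ 2))
      rw [hf, sub_comp, matrixForm_comp, X_comp, hTdef]
      rw [hTdef] at h2
      convert h2 using 1
      ring
    rw [← hf, ← modByMonic_eq_zero_iff_dvd hPm]
    have hdeg : (f %ₘ P).degree < n := by
      have := degree_modByMonic_lt f hPm
      rwa [degree_eq_natDegree hPm.ne_zero, hPn] at this
    -- The remainder gives a relation among the first `n` powers of `T`, which are independent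
    -- modulo `p`.
    have hrT : p ∣ (f %ₘ P).comp T := by
      rw [modByMonic_eq_sub_mul_div, sub_comp, mul_comp]
      exact dvd_sub hfT (hPT.mul_right _)
    rw [← polyOfCoeffs_coeff hdeg, comp_polyOfCoeffs] at hrT
    have h0 := eq_zero_of_dvd_sum hp T hT _ hrT
    rw [← polyOfCoeffs_coeff hdeg, h0]
    simp [polyOfCoeffs]
  · ext l
    have h1 := hc l
    rw [← modByMonic_eq_zero_iff_dvd hp, sub_modByMonic, sub_eq_zero] at h1
    rw [powerCoeff_eq T _ _ h1]
    simp [polyOfCoeffs_coeff_fin]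

end ValueMonoid

/-! ### Unit values over the local ring -/

section Local

variable {R ι : Type*} [CommRing R] [IsLocalRing R] [CharZero (IsLocalRing.ResidueField R)]
  [Fintype ι]

open IsLocalRing

/-- At a root `r` of the reduction of `p` the form takes the value `x(r) ≠ 0`, so it does not vanish
identically over the residue field. -/
theorem exists_matrixForm_isUnit (a : Matrix ι ι R) {p x : R[X]} {v : ι → R[X]} (hp : p.Monic)
    (hn : p.natDegree ≠ 0) (hx : IsCoprime p x) (hv : p ∣ matrixForm (a.map C) v - x) :
    ∃ w : ι → R, IsUnit (matrixForm a w) := by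
  obtain ⟨φ, hφ⟩ : ∃ φ : R →+* AlgebraicClosure (ResidueField R),
    φ = (algebraMap (ResidueField R) _).comp (residue R) := ⟨_, rfl⟩
  have hd : (p.map φ).degree ≠ 0 := by
    rw [degree_eq_natDegree (hp.map φ).ne_zero, hp.natDegree_map]
    exact_mod_cast hn
  obtain ⟨r, hr⟩ := IsAlgClosed.exists_root _ hd
  have hxr : (x.map φ).eval r ≠ 0 := by
    obtain ⟨b, c, hbc⟩ := hx
    intro h0
    have := congrArg (fun f => eval r (f.map φ)) hbc
    simp [h0, hr.eq_zero] at this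
  have hvr := matrixForm_eval_root _ (map_dvd_matrixForm_sub φ hv) hr
  obtain ⟨w, hw⟩ := exists_isUnit_eval (algebraMap (ResidueField R) _)
    (matrixForm (a.map MvPolynomial.C) (MvPolynomial.X (R := R))) (fun l => ((v l).map φ).eval r) (by
      rw [← hφ, ← MvPolynomial.coe_eval₂Hom, ← matrixForm_map]
      convert hvr.trans_ne hxr
      · ext
        simp
      · simp)
  refine ⟨w, ?_⟩
  rw [← matrixForm_map] at hw
  convert hw
  · ext; simp
  · ext; simp

end Local

open IsLocalRing

/-! ### Passing to a polynomial with separable reduction -/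

section Deformation

variable {k ι : Type*} [Field k] [CharZero k] [Fintype ι]

/-- At each root `r` the vector `v(r)` has form value `r ≠ 0`, so it is itself a direction not
orthogonal to `v(r)`. Hence each condition on `w` is a nonzero polynomial, and `k` is infinite. -/
theorem exists_direction (a : Matrix ι ι k) {p : k[X]} {v : ι → k[X]} (hp : p.Monic)
    (hn : p.natDegree ≠ 0) (h0 : p.eval 0 ≠ 0) (hv : p ∣ matrixForm (a.map C) v - X) :
    ∃ w : ι → k, matrixForm a w ≠ 0 ∧ IsCoprime p (v ⬝ᵥ (a.map C *ᵥ (C ∘ w))) := by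
  classical
  let K := AlgebraicClosure k
  obtain ⟨φ, hφ⟩ : ∃ φ : k →+* K, φ = algebraMap k K := ⟨_, rfl⟩
  obtain ⟨z, hz⟩ : ∃ z : K → ι → K, z = fun r l => ((v l).map φ).eval r := ⟨_, rfl⟩
  have hroot {r : K} (hr : (p.map φ).IsRoot r) : matrixForm (a.map φ) (z r) = r ∧ r ≠ 0 := by
    have := matrixForm_eval_root _ (map_dvd_matrixForm_sub φ hv) hr
    rw [map_X, eval_X] at this
    refine ⟨hz ▸ this, ?_⟩
    rintro rfl
    rw [IsRoot.def, eval_zero_map, map_eq_zero] at hr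
    exact h0 hr
  obtain ⟨G, hG⟩ : ∃ G : MvPolynomial ι K,
      G = matrixForm ((a.map φ).map MvPolynomial.C) (MvPolynomial.X (R := K)) *
        ∏ r ∈ (p.map φ).roots.toFinset,
          (MvPolynomial.C ∘ z r) ⬝ᵥ ((a.map φ).map MvPolynomial.C *ᵥ MvPolynomial.X (R := K)) :=
    ⟨_, rfl⟩
  have hmap (y : ι → K) : ((a.map φ).map MvPolynomial.C).map (MvPolynomial.eval y) = a.map φ := by
    ext
    simp
  have heval (y : ι → K) : MvPolynomial.eval y G = matrixForm (a.map φ) y *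
      ∏ r ∈ (p.map φ).roots.toFinset, z r ⬝ᵥ (a.map φ *ᵥ y) := by
    rw [hG, map_mul, map_prod, ← matrixForm_map, hmap]
    congr 1
    · congr 1
      ext
      simp
    · refine Finset.prod_congr rfl fun r _ => ?_
      rw [map_dotProduct_mulVec, hmap]
      congr 1
      · ext
        simp
      · congr 1
        ext
        simp
  have hmem {r : K} : r ∈ (p.map φ).roots.toFinset ↔ (p.map φ).IsRoot r := by
    rw [Multiset.mem_toFinset, mem_roots (hp.map φ).ne_zero]
  have hG0 : G ≠ 0 := by
    have hd : (p.map φ).degree ≠ 0 := by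
      rw [degree_eq_natDegree (hp.map φ).ne_zero, hp.natDegree_map]
      exact_mod_cast hn
    obtain ⟨r, hr⟩ := IsAlgClosed.exists_root _ hd
    rw [hG]
    refine mul_ne_zero ?_ (Finset.prod_ne_zero_iff.2 fun s hs => ?_)
    · intro h
      have := congrArg (MvPolynomial.eval (z r)) h
      rw [← matrixForm_map, hmap, map_zero] at this
      refine (hroot hr).2 ((hroot hr).1 ▸ this ▸ ?_)
      congr 1
      ext
      simp
    · have hs := hroot (hmem.1 hs)
      intro h
      have := congrArg (MvPolynomial.eval (z s)) h
      rw [map_dotProduct_mulVec, hmap, map_zero] at this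
      refine hs.2 (hs.1 ▸ this ▸ ?_)
      rw [matrixForm]
      congr 1
      · ext
        simp
      · congr 1
        ext
        simp
  obtain ⟨w, hw⟩ := exists_eval_algebraMap_ne_zero (k := k) hG0
  rw [heval, mul_ne_zero_iff, Finset.prod_ne_zero_iff, ← hφ, matrixForm_map,
    _root_.map_ne_zero] at hw
  refine ⟨w, hw.1, ?_⟩
  rw [Polynomial.isCoprime_iff_aeval_ne_zero_of_isAlgClosed k K]
  intro r
  by_cases hr : (p.map φ).IsRoot r
  · right
    rw [← AlgHom.coe_toRingHom, map_dotProduct_mulVec]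
    convert hw.2 r (hmem.2 hr)
    · ext l
      simp [hz, hφ]
    · ext i j
      simp [hφ]
    · ext l
      simp [hφ]
  · left
    rwa [IsRoot.def, hφ, eval_map_algebraMap] at hr

end Deformation

section Local

variable {R ι : Type*} [CommRing R] [IsLocalRing R] [CharZero (ResidueField R)] [Fintype ι]

/-- Replacing `v` by `v + p w` gives `q(v + p w) - X = p (h + 2 B + p c)` with `c = q(w)`, so `P = p
+ c⁻¹ (h + 2 B)` is a new divisor. Evaluation at `0` shows that `p(0) P(0) c` is a value of `q`. -/
theorem exists_separable (a : Matrix ι ι R) (ha : a.IsSymm) {n : ℕ} {p : R[X]} {v : ι → R[X]}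
    (hp : p.Monic) (hn : p.natDegree = n + 2) (h0 : IsUnit (p.eval 0))
    (hvd : ∀ l, (v l).natDegree ≤ n + 1) (hv : p ∣ matrixForm (a.map C) v - X) :
    ∃ (P : R[X]) (u : ι → R[X]), P.Monic ∧ P.natDegree = n + 2 ∧ (P.map (residue R)).Separable ∧
      IsUnit (P.eval 0) ∧ P ∣ matrixForm (a.map C) u - X ∧
      p.eval 0 * P.eval 0 ∈ matrixFormValues a := by
  have h0' : (p.map (residue R)).eval 0 ≠ 0 := by
    rw [eval_zero_map, residue_ne_zero_iff_isUnit]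
    exact h0
  have hv' := map_dvd_matrixForm_sub (residue R) hv
  rw [map_X] at hv'
  obtain ⟨w₀, hw₀, hcop⟩ := exists_direction (a.map (residue R)) (hp.map (residue R))
    (by rw [hp.natDegree_map, hn]; lia) h0' hv'
  obtain ⟨h, hh⟩ := hv
  have hhd : h.natDegree ≤ n := by
    by_cases hz : h = 0
    · simp [hz]
    have h1 := congrArg natDegree hh
    rw [hp.natDegree_mul' hz, hn] at h1
    have h2 := natDegree_sub_le_of_le (natDegree_matrixForm_le a hvd) (natDegree_X_le (R := R))
    have h3 : max (2 * (n + 1)) 1 = 2 * (n + 1) := max_eq_left (by lia)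
    lia
  obtain ⟨a₀, ha₀⟩ : ∃ a₀, a₀ = matrixForm (a.map (residue R)) w₀ := ⟨_, rfl⟩
  rw [← ha₀] at hw₀
  obtain ⟨b, hb⟩ : ∃ b, b = (fun l => (v l).map (residue R)) ⬝ᵥ
    ((a.map (residue R)).map C *ᵥ (C ∘ w₀)) := ⟨_, rfl⟩
  rw [← hb] at hcop
  have hbd : b.natDegree ≤ n + 1 := by
    rw [hb]
    refine natDegree_sum_le_of_forall_le _ _ fun l _ => ?_
    have : (((a.map (residue R)).map C *ᵥ (C ∘ w₀)) l) = C ((a.map (residue R) *ᵥ w₀) l) :=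
      (RingHom.map_mulVec C _ _ l).symm
    rw [this]
    exact (natDegree_mul_C_le _ _).trans (natDegree_map_le.trans (hvd l))
  obtain ⟨d, hd0, hd⟩ := exists_separable_deformation (hp.map (residue R)) rfl
    (g := C (2 / a₀) * b) (h := C (1 / a₀) * h.map (residue R))
    (by rw [hp.natDegree_map, hn]; exact (natDegree_C_mul_le _ _).trans_lt (by lia))
    (by
      rw [hp.natDegree_map, hn]
      exact (natDegree_C_mul_le _ _).trans_lt (natDegree_map_le.trans_lt (by lia)))
    ((isCoprime_mul_unit_left_right (isUnit_C.2 (div_ne_zero two_ne_zero hw₀).isUnit) _ _).2 hcop)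
  -- The factors make `μ` invertible, `P` separable modulo the maximal ideal, and `P(0)` a unit; the
  -- last one is `p(0)² a₀` at `μ = 0`.
  obtain ⟨μ, hμ⟩ : ∃ μ, (X * d * matrixForm ((a.map (residue R)).map C) (fun l =>
      C (((v l).map (residue R)).eval 0) * X + C ((p.map (residue R)).eval 0 * w₀ l))).eval μ ≠ 0 := by
    by_contra! hz
    have h1 := Polynomial.funext (q := 0) fun μ => (hz μ).trans eval_zero.symm
    refine mul_ne_zero (mul_ne_zero X_ne_zero hd0) (fun h2 => ?_) h1
    have h3 := congrArg (eval 0) h2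
    have h4 : (fun l => (C (((v l).map (residue R)).eval 0) * X +
        C ((p.map (residue R)).eval 0 * w₀ l)).eval 0) = (p.map (residue R)).eval 0 • w₀ := by
      ext l
      simp
    rw [eval_matrixForm, h4, matrixForm_smul, eval_zero, ← ha₀] at h3
    exact mul_ne_zero (pow_ne_zero 2 h0') hw₀ h3
  rw [eval_mul, eval_mul, eval_X, mul_ne_zero_iff, mul_ne_zero_iff, eval_matrixForm] at hμ
  obtain ⟨⟨hμ0, hμd⟩, hμv⟩ := hμ
  -- Scaling by `μ⁻¹` makes `P` reduce to `p + μ (2/a₀) b + μ² (1/a₀) h`.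
  choose w hw using fun l => residue_surjective (μ⁻¹ * w₀ l)
  have hw' : residue R ∘ w = μ⁻¹ • w₀ := funext hw
  obtain ⟨c, hc⟩ : IsUnit (matrixForm a w) := by
    rw [← residue_ne_zero_iff_isUnit, ← matrixForm_map, hw', matrixForm_smul, ← ha₀]
    exact mul_ne_zero (pow_ne_zero 2 (inv_ne_zero hμ0)) hw₀
  have hcres : residue R c = (μ⁻¹) ^ 2 * a₀ := by
    rw [hc, ← matrixForm_map, hw', matrixForm_smul, ← ha₀]
  have hcinv : residue R (c⁻¹ : Rˣ) = μ ^ 2 / a₀ := by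
    have : residue R (c⁻¹ : Rˣ) * residue R c = 1 := by rw [← map_mul, Units.inv_mul, map_one]
    rw [hcres] at this
    field_simp at this ⊢
    exact this
  obtain ⟨B, hB⟩ : ∃ B, B = v ⬝ᵥ (a.map C *ᵥ (C ∘ w)) := ⟨_, rfl⟩
  have hBres : B.map (residue R) = C μ⁻¹ * b := by
    have h1 : mapRingHom (residue R) ∘ C ∘ w = C μ⁻¹ • (C ∘ w₀) := by
      ext1 l
      simp [hw]
    rw [hB, ← coe_mapRingHom, map_dotProduct_mulVec, h1, mulVec_smul, dotProduct_smul, hb,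
      smul_eq_mul]
    congr 3
    ext1 i j
    simp
  have hBd : B.natDegree ≤ n + 1 := by
    rw [hB]
    refine natDegree_sum_le_of_forall_le _ _ fun l _ => ?_
    have : ((a.map C *ᵥ (C ∘ w)) l) = C ((a *ᵥ w) l) :=
      (RingHom.map_mulVec C _ _ l).symm
    rw [this]
    exact (natDegree_mul_C_le _ _).trans (hvd l)
  obtain ⟨q, hq⟩ : ∃ q, q = C ((c⁻¹ : Rˣ) : R) * (h + 2 * B) := ⟨_, rfl⟩
  have hqd : q.natDegree ≤ n + 1 := by
    rw [hq]
    refine (natDegree_C_mul_le _ _).trans (natDegree_add_le_of_degree_le (hhd.trans n.le_succ) ?_)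
    rw [← C_ofNat]
    exact (natDegree_C_mul_le _ _).trans hBd
  have hcc : C ((c⁻¹ : Rˣ) : R) * C (c : R) = 1 := by rw [← C_mul, Units.inv_mul, C_1]
  have hform : matrixForm (a.map C) (v + p • (C ∘ w)) - X = p * (C (c : R) * (p + q)) := by
    have h1 : matrixForm (a.map C) (C ∘ w) = C (c : R) := by rw [matrixForm_map, hc]
    rw [matrixForm_add (ha.map _), matrixForm_smul, h1, mulVec_smul, dotProduct_smul, ← hB, hq,
      smul_eq_mul]
    linear_combination hh - p * (h + 2 * B) * hcc
  have hP0 : p.eval 0 * (p + q).eval 0 * c =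
      matrixForm a (fun l => (v l).eval 0 + p.eval 0 * w l) := by
    have := congrArg (eval 0) hform
    rw [eval_sub, eval_X, sub_zero, eval_matrixForm, eval_mul, eval_mul, eval_C] at this
    rw [mul_assoc, mul_comm _ (c : R), ← this]
    simp
  have hPu : IsUnit (matrixForm a (fun l => (v l).eval 0 + p.eval 0 * w l)) := by
    rw [← residue_ne_zero_iff_isUnit, ← matrixForm_map]
    have h1 : residue R ∘ (fun l => (v l).eval 0 + p.eval 0 * w l) = μ⁻¹ •
        fun l => (C (((v l).map (residue R)).eval 0) * X +
          C ((p.map (residue R)).eval 0 * w₀ l)).eval μ := by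
      ext l
      simp only [Function.comp_apply, map_add, map_mul, hw, eval_zero_map, Pi.smul_apply, eval_add,
        eval_mul, eval_C, eval_X, smul_eq_mul]
      field_simp
    rw [h1, matrixForm_smul]
    exact mul_ne_zero (pow_ne_zero 2 (inv_ne_zero hμ0)) hμv
  have hdeg : q.natDegree < p.natDegree := by lia
  refine ⟨p + q, v + p • (C ∘ w), hp.add_of_left (degree_lt_degree hdeg), ?_, ?_, ?_, ?_, ?_⟩
  · rw [natDegree_add_eq_left_of_natDegree_lt hdeg, hn]
  · convert hd μ hμd using 1
    rw [Polynomial.map_add, hq, Polynomial.map_mul, map_C, hcinv, Polynomial.map_add,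
      Polynomial.map_mul, hBres, Polynomial.map_ofNat, ← C_ofNat]
    have h1 : C (μ ^ 2 / a₀) * (C 2 * (C μ⁻¹ * b)) = C μ * (C (2 / a₀) * b) := by
      simp only [← mul_assoc, ← C_mul]
      congr 2
      field_simp
    have h2 : C (μ ^ 2 / a₀) = C (μ ^ 2) * C (1 / a₀) := by rw [← C_mul]; ring_nf
    rw [mul_add, h1, h2]
    ring
  · rw [← hP0] at hPu
    exact isUnit_of_mul_isUnit_right (isUnit_of_mul_isUnit_left hPu)
  · rw [hform]
    exact Dvd.intro_left (p * C (c : R)) (by ring)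
  · refine mem_values_of_mul (r := (c : R)) (hc ▸ matrixForm_mem_values (hc ▸ c.isUnit)) ?_
    rw [mul_comm, hP0]
    exact matrixForm_mem_values hPu

end Local

/-! ### The norm principle modulo `p` -/

theorem isCoprime_X_of_isUnit {A : Type*} [CommRing A] {p : A[X]} (h : IsUnit (p.eval 0)) :
    IsCoprime p X := by
  obtain ⟨c, hc⟩ := h
  refine ⟨C ((c⁻¹ : Aˣ) : A), -C ((c⁻¹ : Aˣ) : A) * p.divX, ?_⟩
  have h1 := divX_mul_X_add p
  rw [coeff_zero_eq_eval_zero, ← hc] at h1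
  have h2 : C ((c⁻¹ : Aˣ) : A) * C (c : A) = 1 := by rw [← C_mul, Units.inv_mul, C_1]
  linear_combination h2 - C ((c⁻¹ : Aˣ) : A) * h1

theorem norm_mk_X {A : Type*} [CommRing A] [Nontrivial A] {n : ℕ} {p : A[X]} (hp : p.Monic)
    (hn : p.natDegree = n) : Algebra.norm A (AdjoinRoot.mk p X) = (-1) ^ n * p.eval 0 := by
  obtain ⟨P, hP, hPn, hdvd, hnorm⟩ := exists_monic_dvd_comp hp hn X
  rw [comp_X] at hdvd
  rw [hnorm, eq_of_monic_of_dvd_of_natDegree_le hp hP hdvd (by lia)]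

section Local

variable {R ι : Type*} [CommRing R] [IsLocalRing R] [CharZero (ResidueField R)] [Fintype ι]

theorem exists_generatorTest_isUnit {n : ℕ} {p x : R[X]} (hp : p.Monic) (hn : p.natDegree = n)
    (hx : IsCoprime p x) (h0 : IsUnit (p.eval 0)) :
    ∃ y : Fin n → R, IsUnit (generatorTest p x y) := by
  let K := AlgebraicClosure (ResidueField R)
  obtain ⟨φ, hφ⟩ : ∃ φ : R →+* K, φ = (algebraMap (ResidueField R) _).comp (residue R) := ⟨_, rfl⟩
  obtain ⟨y₀, hy₀⟩ := exists_generatorTest_ne_zero (K := K) two_ne_zero (hp.map φ)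
    ((hp.natDegree_map φ).trans hn) (hx.map (mapRingHom φ))
    (by rw [eval_zero_map]; exact (h0.map φ).ne_zero)
  have key {B : Type _} [CommRing B] (ψ : MvPolynomial (Fin n) R →+* B) :
      ψ (generatorTest (p.map MvPolynomial.C) (x.map MvPolynomial.C) MvPolynomial.X) =
        generatorTest (p.map (ψ.comp MvPolynomial.C)) (x.map (ψ.comp MvPolynomial.C))
          (ψ ∘ MvPolynomial.X) := by
    rw [← generatorTest_map _ (hp.map _), Polynomial.map_map, Polynomial.map_map]
  obtain ⟨y, hy⟩ := exists_isUnit_eval (algebraMap (ResidueField R) K)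
    (generatorTest (p.map MvPolynomial.C) (x.map MvPolynomial.C) MvPolynomial.X) y₀ (by
      rw [← hφ, ← MvPolynomial.coe_eval₂Hom, key]
      convert hy₀ <;> ext <;> simp)
  refine ⟨y, ?_⟩
  rw [key] at hy
  convert hy <;> ext <;> simp

theorem exists_coeffTest_isUnit (a : Matrix ι ι R) {n : ℕ} {p : R[X]} {v : ι → R[X]}
    (hp : p.Monic) (hn : p.natDegree = n + 2) (hsep : (p.map (residue R)).Separable)
    (h0 : IsUnit (p.eval 0)) (hv : p ∣ matrixForm (a.map C) v - X) :
    ∃ y : Fin (n + 2) → R, IsUnit (generatorTest p X y * coeffTest a p v 0 y *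
      coeffTest a p v (Fin.last _) y) := by
  let K := AlgebraicClosure (ResidueField R)
  obtain ⟨φ, hφ⟩ : ∃ φ : R →+* K, φ = (algebraMap (ResidueField R) _).comp (residue R) := ⟨_, rfl⟩
  obtain ⟨y₀, hy₀⟩ := exists_coeffTest_ne_zero (K := K) (a.map φ) (hp.map φ)
    ((hp.natDegree_map φ).trans hn) (by rw [hφ, ← Polynomial.map_map]; exact hsep.map)
    (by rw [eval_zero_map]; exact (h0.map φ).ne_zero)
    (by rw [← map_X φ]; exact map_dvd_matrixForm_sub φ hv)
  have key {B : Type _} [CommRing B] (ψ : MvPolynomial (Fin (n + 2)) R →+* B) :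
      ψ (generatorTest (p.map MvPolynomial.C) (X.map MvPolynomial.C) MvPolynomial.X *
        coeffTest (a.map MvPolynomial.C) (p.map MvPolynomial.C) (fun l => (v l).map MvPolynomial.C)
          0 MvPolynomial.X *
        coeffTest (a.map MvPolynomial.C) (p.map MvPolynomial.C) (fun l => (v l).map MvPolynomial.C)
          (Fin.last _) MvPolynomial.X) =
        generatorTest (p.map (ψ.comp MvPolynomial.C)) X (ψ ∘ MvPolynomial.X) *
        coeffTest (a.map (ψ.comp MvPolynomial.C)) (p.map (ψ.comp MvPolynomial.C))
          (fun l => (v l).map (ψ.comp MvPolynomial.C)) 0 (ψ ∘ MvPolynomial.X) *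
        coeffTest (a.map (ψ.comp MvPolynomial.C)) (p.map (ψ.comp MvPolynomial.C))
          (fun l => (v l).map (ψ.comp MvPolynomial.C)) (Fin.last _) (ψ ∘ MvPolynomial.X) := by
    rw [map_mul, map_mul, ← generatorTest_map _ (hp.map _), ← coeffTest_map _ _ (hp.map _),
      ← coeffTest_map _ _ (hp.map _)]
    simp only [Polynomial.map_map, Matrix.map_map, map_X, RingHom.coe_comp]
  obtain ⟨y, hy⟩ := exists_isUnit_eval (algebraMap (ResidueField R) K) _ y₀ (by
      rw [← hφ, ← MvPolynomial.coe_eval₂Hom, key]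
      have h1 : (MvPolynomial.eval₂Hom φ y₀).comp MvPolynomial.C = φ := by ext; simp
      have h2 : MvPolynomial.eval₂Hom φ y₀ ∘ MvPolynomial.X = y₀ := by ext; simp
      rw [h1, h2]
      exact hy₀)
  refine ⟨y, ?_⟩
  have h1 : (MvPolynomial.eval y).comp MvPolynomial.C = RingHom.id R := by ext; simp
  have h2 : MvPolynomial.eval y ∘ MvPolynomial.X = y := by ext; simp
  rw [key, h1, h2] at hy
  simpa only [Polynomial.map_id, RingHom.coe_id, Matrix.map_id] using hy

/-- The factor `r` is the norm of `Y`, since `X Y²` has norm `N(X) N(Y)²`. -/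
theorem exists_isUnit_coeff (a : Matrix ι ι R) {n : ℕ} {p : R[X]} {v : ι → R[X]}
    (hp : p.Monic) (hn : p.natDegree = n + 2) (hsep : (p.map (residue R)).Separable)
    (h0 : IsUnit (p.eval 0)) (hv : p ∣ matrixForm (a.map C) v - X) :
    ∃ (P : R[X]) (u : ι → R[X]) (r : R), P.Monic ∧ P.natDegree = n + 2 ∧ IsUnit r ∧
      P.eval 0 = p.eval 0 * r ^ 2 ∧ (∀ l, (u l).natDegree ≤ n + 1) ∧
      P ∣ matrixForm (a.map C) u - X ∧ IsUnit (matrixForm a fun l => (u l).coeff 0) ∧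
      IsUnit (matrixForm a fun l => (u l).coeff (n + 1)) := by
  obtain ⟨y, hy⟩ := exists_coeffTest_isUnit a hp hn hsep h0 hv
  rw [IsUnit.mul_iff, IsUnit.mul_iff, generatorTest, IsUnit.mul_iff, coeffTest, coeffTest,
    ← norm_mk_eq_det hp hn] at hy
  obtain ⟨⟨⟨hT, hN⟩, hy0⟩, hyn⟩ := hy
  obtain ⟨P, u, hP, hPn, hnorm, hu, hPu, hcoeff⟩ := exists_change_generator a hp hn X _ hv hT
  rw [hcoeff, matrixForm_smul] at hy0 hyn
  rw [map_mul, map_pow, map_mul, map_pow, norm_mk_X hp hn] at hN hnorm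
  refine ⟨P, u, Algebra.norm R (AdjoinRoot.mk p (polyOfCoeffs y)), hP, hPn, ?_, ?_, hu, hPu,
    isUnit_of_mul_isUnit_right hy0, isUnit_of_mul_isUnit_right hyn⟩
  · exact (isUnit_pow_iff two_ne_zero).1 (isUnit_of_mul_isUnit_right hN)
  · have h1 : ((-1 : R) ^ (n + 2)) * (-1) ^ (n + 2) = 1 := by rw [← mul_pow]; simp
    linear_combination (-(-1) ^ (n + 2)) * hnorm +
      (p.eval 0 * Algebra.norm R (AdjoinRoot.mk p (polyOfCoeffs y)) ^ 2 - P.eval 0) * h1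

theorem eval_zero_mem_values (a : Matrix ι ι R) (ha : a.IsSymm) (n : ℕ) {p : R[X]}
    {v : ι → R[X]} (hp : p.Monic) (hn : p.natDegree = n) (h0 : IsUnit (p.eval 0))
    (hv : p ∣ matrixForm (a.map C) v - X) : (-1) ^ n * p.eval 0 ∈ matrixFormValues a := by
  induction n using Nat.twoStepInduction generalizing p v with
  | zero =>
    rw [eq_one_of_monic_natDegree_zero hp hn]
    simp
  | one =>
    obtain ⟨c, hc⟩ : ∃ c, p = X + C c := ⟨_, hp.eq_X_add_C hn⟩
    have h1 := matrixForm_eval_root a hv (r := -c) (by simp [hc])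
    rw [eval_X] at h1
    have h2 : (-1 : R) ^ 1 * p.eval 0 = -c := by simp [hc]
    rw [h2, ← h1]
    refine matrixForm_mem_values ?_
    rw [h1, IsUnit.neg_iff]
    simpa [hc] using h0
  | more n ih _ =>
    obtain ⟨w, hw⟩ := exists_matrixForm_isUnit a hp (by lia) (isCoprime_X_of_isUnit h0) hv
    -- Reducing `v` modulo `p` provides the degree bound that the descent needs.
    have hv' : p ∣ matrixForm (a.map C) (fun l => v l %ₘ p) - X := by
      have : p ∣ matrixForm (a.map C) (fun l => v l %ₘ p) - matrixForm (a.map C) v :=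
        dvd_matrixForm_sub _ fun l => by
          rw [modByMonic_eq_sub_mul_div, sub_sub_cancel_left, dvd_neg]
          exact dvd_mul_right _ _
      simpa using dvd_add this hv
    obtain ⟨p₁, v₁, hp₁, hn₁, hsep, h0₁, hv₁, hmem⟩ := exists_separable a ha hp hn h0
      (fun l => by
        have := natDegree_modByMonic_lt (v l) hp (fun h => by simp [h] at hn)
        lia) hv'
    obtain ⟨P, u, r, hP, hPn, hr, hPr, hud, hu, hu0, hun⟩ :=
      exists_isUnit_coeff a hp₁ hn₁ hsep h0₁ hv₁
    obtain ⟨h, hh⟩ := hu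
    obtain ⟨c, hc⟩ := hun
    have hfd : (matrixForm (a.map C) u - X).natDegree ≤ 2 * (n + 1) :=
      (natDegree_sub_le_of_le (natDegree_matrixForm_le a hud) natDegree_X_le).trans
        (max_le le_rfl (by lia))
    -- The term `X` does not reach degree `2 (n + 1)`, so the leading coefficient is the form at the
    -- top coefficients of `u`.
    have hfc : (matrixForm (a.map C) u - X).coeff (2 * (n + 1)) = (c : R) := by
      rw [coeff_sub, coeff_matrixForm a hud, ← hc, coeff_X_of_ne_one (by lia), sub_zero]
    have hh0 : h ≠ 0 := by
      rintro rfl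
      rw [hh, mul_zero, coeff_zero] at hfc
      exact c.ne_zero hfc.symm
    have hhd : h.natDegree ≤ n := by
      rw [hh, hP.natDegree_mul' hh0, hPn] at hfd
      lia
    have hhc : h.coeff n = (c : R) := by
      rw [hh, show 2 * (n + 1) = (n + 2) + n by ring,
        coeff_mul_add_eq_of_natDegree_le hPn.le hhd, ← hPn, hP.coeff_natDegree, one_mul] at hfc
      exact hfc
    obtain ⟨g, hg⟩ : ∃ g, g = C ((c⁻¹ : Rˣ) : R) * h := ⟨_, rfl⟩
    have hhg : h = C (c : R) * g := by
      rw [hg, ← mul_assoc, ← C_mul, Units.mul_inv, C_1, one_mul]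
    have hgd : g.natDegree ≤ n := hg ▸ (natDegree_C_mul_le _ _).trans hhd
    have hgc : g.coeff n = 1 := by rw [hg, coeff_C_mul, hhc, Units.inv_mul]
    have hgm : g.Monic := monic_of_natDegree_le_of_coeff_eq_one n hgd hgc
    have hgn : g.natDegree = n := le_antisymm hgd (le_natDegree_of_ne_zero (by simp [hgc]))
    have heval : (matrixForm a fun l => (u l).coeff 0) = P.eval 0 * (c * g.eval 0) := by
      have := congrArg (eval 0) hh
      rw [eval_sub, eval_X, sub_zero, eval_matrixForm, hhg, eval_mul, eval_mul, eval_C] at this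
      simpa only [coeff_zero_eq_eval_zero] using this
    have hg0 : IsUnit (g.eval 0) := by
      rw [heval] at hu0
      exact isUnit_of_mul_isUnit_right (isUnit_of_mul_isUnit_right hu0)
    -- The cofactor `g` divides the same expression, so the same `u` serves.
    have hgmem := ih hgm hgn hg0 (v := u) (by rw [hh, hhg]; exact ⟨P * C (c : R), by ring⟩)
    have hcmem : (c : R) ∈ matrixFormValues a := hc ▸ matrixForm_mem_values (hc ▸ c.isUnit)
    have hPmem : (-1) ^ (n + 2) * P.eval 0 ∈ matrixFormValues a := by
      refine mem_values_of_mul (mul_mem hgmem hcmem) ?_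
      have h1 : ((-1 : R) ^ n) * (-1) ^ n = 1 := by rw [← mul_pow]; simp
      have : (-1) ^ n * g.eval 0 * c * ((-1) ^ (n + 2) * P.eval 0) =
          matrixForm a fun l => (u l).coeff 0 := by
        rw [heval]
        linear_combination (g.eval 0 * c * P.eval 0) * h1
      rw [this]
      exact matrixForm_mem_values hu0
    have hp₁mem : (-1) ^ (n + 2) * p₁.eval 0 ∈ matrixFormValues a := by
      refine mem_values_of_mul (sq_mem_values hw hr) ?_
      convert hPmem using 1
      rw [hPr]
      ring
    -- It remains to return from `p₁` to `p`, using that `p(0) p₁(0)` is in the value group.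
    refine mem_values_of_mul hp₁mem ?_
    convert hmem using 1
    have h1 : ((-1 : R) ^ n) * (-1) ^ n = 1 := by rw [← mul_pow]; simp
    linear_combination (p.eval 0 * p₁.eval 0) * h1

theorem norm_mk_mem_values (a : Matrix ι ι R) (ha : a.IsSymm) {p x : R[X]} {v : ι → R[X]}
    (hp : p.Monic) (hn : p.natDegree ≠ 0) (h0 : IsUnit (p.eval 0)) (hx : IsCoprime p x)
    (hv : p ∣ matrixForm (a.map C) v - x) :
    Algebra.norm R (AdjoinRoot.mk p x) ∈ matrixFormValues a := by
  obtain ⟨w, hw⟩ := exists_matrixForm_isUnit a hp hn hx hv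
  obtain ⟨y, hy⟩ := exists_generatorTest_isUnit hp rfl hx h0
  rw [generatorTest, IsUnit.mul_iff, ← norm_mk_eq_det hp rfl] at hy
  obtain ⟨P, u, hP, hPn, hnorm, -, hPu, -⟩ := exists_change_generator a hp rfl x _ hv hy.1
  have hN := hy.2
  have hmem := eval_zero_mem_values a ha _ hP hPn
    (by rw [hnorm] at hN; exact isUnit_of_mul_isUnit_right hN) hPu
  rw [← hnorm] at hmem
  rw [map_mul, map_pow, map_mul, map_pow] at hN hmem
  refine mem_values_of_mul (sq_mem_values hw
    ((isUnit_pow_iff two_ne_zero).1 (isUnit_of_mul_isUnit_right hN))) ?_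
  rwa [mul_comm]

end Local

/-! ### Transfer to the extension and the quadratic module -/

/-- A ring with a basis of powers of an element `c` is the quotient of the polynomial ring by the
characteristic polynomial of `c`. -/
theorem exists_algEquiv_adjoinRoot {R S : Type*} [CommRing R] [Nontrivial R] [CommRing S]
    [Algebra R S] {n : ℕ} (c : S) (b : Module.Basis (Fin n) R S) (hb : ∀ i, b i = c ^ (i : ℕ)) :
    ∃ p : R[X], p.Monic ∧ p.natDegree = n ∧ Algebra.norm R c = (-1) ^ n * p.eval 0 ∧
      Nonempty (AdjoinRoot p ≃ₐ[R] S) := by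
  obtain ⟨p, hpdef⟩ : ∃ p, p = (Algebra.leftMulMatrix b c).charpoly := ⟨_, rfl⟩
  have hp : p.Monic := hpdef ▸ charpoly_monic _
  have hn : p.natDegree = n := by rw [hpdef, charpoly_natDegree_eq_dim, Fintype.card_fin]
  have hc : aeval c p = 0 := by
    apply Algebra.leftMulMatrix_injective b
    rw [← aeval_algHom_apply, hpdef, aeval_self_charpoly, map_zero]
  refine ⟨p, hp, hn, ?_, ⟨AlgEquiv.ofBijective (AdjoinRoot.liftAlgHom p (Algebra.ofId R S) c hc) ?_⟩⟩
  · rw [Algebra.norm_eq_matrix_det b, det_eq_sign_charpoly_coeff, coeff_zero_eq_eval_zero,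
      Fintype.card_fin, hpdef]
  · have : (AdjoinRoot.liftAlgHom p (Algebra.ofId R S) c hc).toLinearMap =
        ((AdjoinRoot.powerBasis' hp).basis.equiv b (finCongr hn)).toLinearMap := by
      refine (AdjoinRoot.powerBasis' hp).basis.ext fun i => ?_
      rw [LinearEquiv.coe_coe, Module.Basis.equiv_apply, hb, PowerBasis.basis_eq_pow]
      rw [AlgHom.toLinearMap_apply, map_pow, AdjoinRoot.powerBasis'_gen]
      congr 1
      exact AdjoinRoot.liftAlgHom_root _ _ _ _
    have h := ((AdjoinRoot.powerBasis' hp).basis.equiv b (finCongr hn)).bijective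
    rw [← LinearEquiv.coe_coe, ← this] at h
    exact h

/-- As `2` is invertible, `q` is given by the symmetric matrix of its associated bilinear form, and
base change only maps the entries. -/
theorem baseChange_eq_matrixForm {R S M ι : Type*} [CommRing R] [Invertible (2 : R)] [CommRing S]
    [Algebra R S] [AddCommGroup M] [Module R M] [Fintype ι] [DecidableEq ι]
    (q : QuadraticForm R M) (b : Module.Basis ι R M) (z : S ⊗[R] M) :
    q.baseChange S z = matrixForm
      ((LinearMap.BilinForm.toMatrix b (QuadraticMap.associated q)).map (algebraMap R S))
      ((Algebra.TensorProduct.basis S b).repr z) := by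
  let : Invertible (2 : S) := (Invertible.map (algebraMap R S) 2).copy 2 (map_ofNat _ _).symm
  rw [← QuadraticMap.associated_eq_self_apply S (q.baseChange S) z,
    QuadraticForm.associated_baseChange,
    LinearMap.BilinForm.apply_eq_dotProduct_toMatrix_mulVec (Algebra.TensorProduct.basis S b)]
  rw [matrixForm]
  congr 2
  ext i j
  simp [LinearMap.BilinForm.toMatrix_apply, Algebra.algebraMap_eq_smul_one]

theorem eq_matrixForm {R M ι : Type*} [CommRing R] [Invertible (2 : R)] [AddCommGroup M]
    [Module R M] [Fintype ι] [DecidableEq ι] (q : QuadraticForm R M) (b : Module.Basis ι R M)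
    (x : ι → R) : q (b.equivFun.symm x) =
      matrixForm (LinearMap.BilinForm.toMatrix b (QuadraticMap.associated q)) x := by
  rw [matrixForm, LinearMap.BilinForm.dotProduct_toMatrix_mulVec,
    QuadraticMap.associated_eq_self_apply]

theorem mainTheorem1 {R S M : Type*}
    [CommRing R] [IsDomain R] [IsLocalRing R] [CharZero (IsLocalRing.ResidueField R)]
    [CommRing S] [Algebra R S] (n : ℕ) (hS : IsSimpleExtension R S n)
    [AddCommGroup M] [Module R M] [Module.Free R M] [Module.Finite R M]
    (q : QuadraticForm R M) (hq : q.IsRegular) :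
    (QuadraticForm.valueGroup (q.baseChange S)).map (Units.map (Algebra.norm R : S →* R)) ≤
      QuadraticForm.valueGroup q := by
  classical
  obtain ⟨hinj, c, b, hb⟩ := hS
  rw [QuadraticForm.valueGroup, MonoidHom.map_closure, Subgroup.closure_le]
  rintro _ ⟨x, ⟨z, hz⟩, rfl⟩
  let bM := Module.Free.chooseBasis R M
  obtain ⟨a, ha⟩ : ∃ a, a = LinearMap.BilinForm.toMatrix bM (QuadraticMap.associated q) := ⟨_, rfl⟩
  have hsymm : a.IsSymm := by
    ext i j
    rw [ha, transpose_apply, LinearMap.BilinForm.toMatrix_apply,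
      LinearMap.BilinForm.toMatrix_apply]
    exact QuadraticMap.associated_isSymm R q _ _
  obtain ⟨p, hp, hn, hpc, ⟨e⟩⟩ := exists_algEquiv_adjoinRoot (c : S) b hb
  -- Rank zero would make `S` trivial, against the injectivity of `R → S`.
  have hn0 : p.natDegree ≠ 0 := by
    rintro h
    rw [h] at hn
    subst hn
    have := b.repr.toEquiv.subsingleton
    exact one_ne_zero (hinj (Subsingleton.elim (algebraMap R S 1) (algebraMap R S 0)))
  have h0 : IsUnit (p.eval 0) := by
    have := c.isUnit.map (Algebra.norm R)
    rw [hpc] at this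
    exact isUnit_of_mul_isUnit_right this
  rw [baseChange_eq_matrixForm q bM, ← ha] at hz
  choose f hf using fun s : S => AdjoinRoot.mk_surjective (e.symm s)
  -- A lift of `x⁻¹` supplies the Bézout relation.
  have hx : IsCoprime p (f x) := by
    have h1 : p ∣ f x * f ((x⁻¹ : Sˣ) : S) - 1 := by
      rw [← AdjoinRoot.mk_eq_zero, map_sub, map_mul, hf, hf, ← map_mul, Units.mul_inv, map_one,
        map_one, sub_self]
    obtain ⟨g, hg⟩ := h1
    exact ⟨-g, f ((x⁻¹ : Sˣ) : S), by linear_combination hg⟩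
  have hv : p ∣ matrixForm (a.map C)
      (fun l => f ((Algebra.TensorProduct.basis S bM).repr z l)) - f x := by
    rw [← AdjoinRoot.mk_eq_zero, map_sub, ← matrixForm_map, hf, ← hz, sub_eq_zero]
    have := matrixForm_map (e.symm : S →+* AdjoinRoot p) (a.map (algebraMap R S))
      ((Algebra.TensorProduct.basis S bM).repr z)
    refine Eq.trans ?_ this
    congr 1
    · ext i j
      simp [AdjoinRoot.algebraMap_eq, AdjoinRoot.mk_C]
    · ext l
      simp [hf]
  have hmem := norm_mk_mem_values a hsymm hp hn0 h0 hx hv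
  rw [hf, Algebra.norm_eq_of_algEquiv] at hmem
  obtain ⟨u, hu, hux⟩ := hmem
  have hux' : Units.map (Algebra.norm R : S →* R) x = u := Units.ext hux.symm
  rw [SetLike.mem_coe, hux']
  refine Subgroup.closure_mono ?_ hu
  rintro w ⟨y, hy⟩
  exact ⟨bM.equivFun.symm y, by rw [eq_matrixForm, ← ha, hy]⟩
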